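/- **Setting.** Two datasets $x,x'\in[0,1]^n$ are adjacent if they differ in at most one entry. An interactive algorithm $M$ for datasets of size $n$ holds $x\in[0,1]^n$ and is given queries $y_1,\dots,y_k\in[0,1]$ one at a time; it must output its (randomized) answer $a_j$ to $y_j$ before seeing $y_{j+1}$. An adversary $A$ chooses each $y_j$, possibly at random, depending on the previous queries and answers. Write $A\leftrightarrows M(x)=(y_1,\dots,y_k,a_1,\dots,a_k)$ for the resulting random transcript. $M$ is $(\varepsilon,\delta)$-differentially private for $k$ queries if for every adversary $A$, all adjacent $x,x'$ and every measurable set $S$ of transcripts, $$\Pr[A\leftrightarrows M(x)\in S]\le e^{\varepsilon}\Pr[A\leftrightarrows M(x')\in S]+\delta .$$ * $M$, with answers in $\{\mathrm L,\mathrm R\}$, *solves the online interior point (OIP) problem for $k$ queries with confidence $\gamma$* if for every adversary and every dataset $x$, with probability at least $1-\gamma$, for all $j\le k$: $y_j<\min_i x_i$ implies $a_j=\mathrm L$, and $y_j\ge\max_i x_i$ implies $a_j=\mathrm R$. * $M$, with answers in $[0,1]$, *answers $k$ adaptively chosen threshold queries with $(\alpha,\beta)$-accuracy* if for every adversary and every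 dataset $x$, with probability at least $1-\beta$, for all $j\le k$: $\left|\frac1n\#\{i: x_i\le y_j\}-a_j\right|\le\alpha$. **Theorem.** Let $\alpha,\beta\in(0,1)$, $\varepsilon>0$, $\delta\ge 0$ and $k,n'\in\mathbb N$. Suppose there is an $(\varepsilon,\delta)$-differentially private algorithm on datasets of size $n'$ that solves the OIP problem for $k$ queries with confidence $\alpha\beta/8$. Then for every integer $$n\ \ge\ \max\left\{\frac{6n'}{\alpha},\ \frac{24\,\log^{2.5}(4/\alpha)\cdot\log(2/\beta)}{\alpha\varepsilon}\right\}$$ (natural logarithms) there is a $(4\varepsilon,(1+e^{\varepsilon})\delta)$-differentially private algorithm on datasets of size $n$ that answers $k$ adaptively chosen threshold queries with $(\alpha,\beta)$-accuracy. -/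

import Mathlib

open MeasureTheory unitInterval

/-- Two datasets of the same size are adjacent if they differ on (at most) a single element. -/
def Adjacent {X : Type*} {n : ℕ} (x x' : Fin n → X) : Prop :=
  ∃ i, ∀ j, j ≠ i → x j = x' j

/-- `(ε, δ)`-differential privacy of a randomized algorithm on datasets of size `n`; the algorithm
is given by the law `B x` of its output on each input `x`. -/
def IsDifferentiallyPrivate {X T : Type*} [MeasurableSpace T] {n : ℕ}
    (B : (Fin n → X) → Measure T) (ε δ : ℝ) : Prop :=
  ∀ x x' : Fin n → X, Adjacent x x' → ∀ S : Set T, MeasurableSet S →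
    (B x).real S ≤ Real.exp ε * (B x').real S + δ

/-- A (stateful, randomized) interactive algorithm that holds a dataset of `n` elements of `X` and
answers queries in `Q`, one at a time, by elements of `R`. All its randomness is in its coins;
its answer in round `j` (rounds are numbered from `0`) may depend on the dataset, on the coins, and
on the queries received so far (including the current one). Since the earlier answers
are determined by the same data, they are available to it as well. -/
structure InteractiveAlgorithm (X Q R : Type) [MeasurableSpace Q] [MeasurableSpace R]
    (n : ℕ) where
  /-- the space of coins -/
  Coins : Type
  [measurableSpaceCoins : MeasurableSpace Coins]
  /-- the law of the coins -/
  law : Measure Coins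
  [isProbabilityMeasure_law : IsProbabilityMeasure law]
  /-- `answer x ω j q` is the answer in round `j`, when the queries so far are `q 0, …, q j` -/
  answer : (Fin n → X) → Coins → (j : ℕ) → (Fin (j + 1) → Q) → R
  measurable_answer : ∀ x j,
    Measurable (fun p : Coins × (Fin (j + 1) → Q) => answer x p.1 j p.2)

attribute [instance] InteractiveAlgorithm.measurableSpaceCoins
  InteractiveAlgorithm.isProbabilityMeasure_law

/-- A (randomized) adaptive adversary: its query in round `j` may depend on its own coins and on all
the answers of the earlier rounds (its own earlier queries are determined by the same data). -/
structure Adversary (Q R : Type) [MeasurableSpace Q] [MeasurableSpace R] where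
  /-- the space of coins -/
  Coins : Type
  [measurableSpaceCoins : MeasurableSpace Coins]
  /-- the law of the coins -/
  law : Measure Coins
  [isProbabilityMeasure_law : IsProbabilityMeasure law]
  /-- `query ω j a` is the query in round `j`, when the answers so far are `a 0, …, a (j - 1)` -/
  query : Coins → (j : ℕ) → (Fin j → R) → Q
  measurable_query : ∀ j, Measurable (fun p : Coins × (Fin j → R) => query p.1 j p.2)

attribute [instance] Adversary.measurableSpaceCoins Adversary.isProbabilityMeasure_law

namespace InteractiveAlgorithm

variable {X Q R : Type} [MeasurableSpace Q] [MeasurableSpace R] {n : ℕ}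

/-- The queries and the answers of the first `k` rounds of the interaction of the adversary `A` with
the algorithm `M` on the dataset `x`, for given coins `ω` of `M` and `ω'` of `A`. -/
def transcript (M : InteractiveAlgorithm X Q R n) (A : Adversary Q R) (x : Fin n → X)
    (ω : M.Coins) (ω' : A.Coins) : (k : ℕ) → (Fin k → Q) × (Fin k → R)
  | 0 => (Fin.elim0, Fin.elim0)
  | k + 1 =>
    let h := M.transcript A x ω ω' k
    let q : Fin (k + 1) → Q := Fin.snoc (α := fun _ => Q) h.1 (A.query ω' k h.2)
    (q, Fin.snoc (α := fun _ => R) h.2 (M.answer x ω k q))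

theorem measurable_snoc_const {Ω T : Type*} [MeasurableSpace Ω] [MeasurableSpace T] {k : ℕ}
    {f : Ω → Fin k → T} {g : Ω → T} (hf : Measurable f) (hg : Measurable g) :
    Measurable (fun p => (Fin.snoc (α := fun _ => T) (f p) (g p) : Fin (k + 1) → T)) := by
  refine measurable_pi_iff.2 fun i => ?_
  refine Fin.lastCases ?_ (fun i => ?_) i
  · simpa using hg
  · simpa using (measurable_pi_iff.1 hf i)

theorem measurable_transcript (M : InteractiveAlgorithm X Q R n) (A : Adversary Q R)
    (x : Fin n → X) (k : ℕ) :
    Measurable (fun p : M.Coins × A.Coins => M.transcript A x p.1 p.2 k) := by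
  induction k with
  | zero => exact measurable_const
  | succ k ih =>
    have hq : Measurable (fun p : M.Coins × A.Coins =>
        (Fin.snoc (α := fun _ => Q) (M.transcript A x p.1 p.2 k).1
          (A.query p.2 k (M.transcript A x p.1 p.2 k).2) : Fin (k + 1) → Q)) :=
      measurable_snoc_const ih.fst ((A.measurable_query k).comp (measurable_snd.prodMk ih.snd))
    exact hq.prodMk
      (measurable_snoc_const ih.snd ((M.measurable_answer x k).comp (measurable_fst.prodMk hq)))

/-- The law of the output (all queries and answers) of the `k`-round online adaptive interaction of
`A` with `M` on input `x`; the coins of `A` and of `M` are independent. -/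
noncomputable def interaction (M : InteractiveAlgorithm X Q R n) (A : Adversary Q R) (k : ℕ)
    (x : Fin n → X) : Measure ((Fin k → Q) × (Fin k → R)) :=
  (M.law.prod A.law).map (fun p => M.transcript A x p.1 p.2 k)

instance (M : InteractiveAlgorithm X Q R n) (A : Adversary Q R) (k : ℕ) (x : Fin n → X) :
    IsProbabilityMeasure (M.interaction A k x) :=
  Measure.isProbabilityMeasure_map (M.measurable_transcript A x k).aemeasurable

/-- `M` is `(ε, δ)`-differentially private when it answers `k` adaptively chosen queries. -/
def IsPrivate (M : InteractiveAlgorithm X Q R n) (k : ℕ) (ε δ : ℝ) : Prop :=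
  ∀ A : Adversary Q R, IsDifferentiallyPrivate (M.interaction A k) ε δ

/-- `M` is `(α, β)`-accurate for `k` adaptively chosen queries, where `loss q x a` is the loss of
the answer `a` to the query `q` on the dataset `x`. -/
def IsAccurate (M : InteractiveAlgorithm X Q R n) (loss : Q → (Fin n → X) → R → ℝ) (k : ℕ)
    (α β : ℝ) : Prop :=
  ∀ (A : Adversary Q R) (x : Fin n → X),
    1 - β ≤ (M.interaction A k x).real {t | ∀ j, loss (t.1 j) x (t.2 j) ≤ α}

end InteractiveAlgorithm

/-- The two possible answers in the online interior point problem. -/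
inductive Side : Type
  | L
  | R

instance : MeasurableSpace Side := ⊤

/-- `M` solves the online interior point problem for `k` adaptively chosen queries with confidence
`β`: with probability at least `1 - β`, every query `y j` below `min x` is answered by `L`, and
every query `y j` that is at least `max x` is answered by `R`. -/
def SolvesOIP {n : ℕ} (M : InteractiveAlgorithm I I Side n) (k : ℕ) (β : ℝ) : Prop :=
  ∀ (A : Adversary I Side) (x : Fin n → I),
    1 - β ≤ (M.interaction A k x).real
      {t | ∀ j, ((∀ i, t.1 j < x i) → t.2 j = Side.L) ∧ ((∀ i, x i ≤ t.1 j) → t.2 j = Side.R)}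

/-- The value on the dataset `x` of the statistical query given by the predicate `q`. -/
noncomputable def statisticalQuery {X : Type*} {n : ℕ} (q : X → ℝ) (x : Fin n → X) : ℝ :=
  (∑ i, q (x i)) / n

/-- The threshold predicate `c_y : [0, 1] → {0, 1}`, with `c_y z = 1` iff `z ≤ y`. -/
noncomputable def threshold (y : I) : I → ℝ := fun z => if z ≤ y then 1 else 0

/-- The error of the answer `a ∈ [0, 1]` to the threshold query `c_y` on the dataset `x`. -/
noncomputable def thresholdLoss {n : ℕ} (y : I) (x : Fin n → I) (a : I) : ℝ :=
  |statisticalQuery (threshold y) x - a|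

/-!
The dataset is sorted and cut into `2 ^ L` leaves, where `2 ^ L` is about `1 / α`. The first `n'`
entries of each leaf are given to a copy of the online interior point algorithm `T`, and every query
is passed to all the copies. An answer `R` of a copy means that the query is not below all of its
data, an answer `L` that it is not above all of its data; hence the first leaf that answers `L`
determines the rank of the query up to the distance of two consecutive leaves (`estimate`,
`thresholdLoss_estimate_le`).

*Privacy.* The cuts have to be randomized, as otherwise a change of one entry could change the data
of every copy. They are made recursively along a complete binary tree of height `L` (`leaves`), each
one at its nominal place plus independent discrete Laplace noise of rate `η = 3 ε / (4 L)`. Inserting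
an entry is matched with moving the cuts behind it by one place: at every level this is an injective
change of the noise, it costs a factor `exp η`, and only one leaf changes, by one entry
(`transports_insert`). Deleting an entry `u` is more subtle: moving the cuts behind `u` one place back
is not injective, since the cuts just before and just after `u` become equal. For this reason `R`
entries are discarded at each cut. If `u` is one of them, then one may either move the cut or keep it,
and only one leaf changes in both cases; choosing at random, with a probability that depends slowly
on the position of `u` in the gap (`shiftProb`), reduces the cost of the collisions to a factor
`1 + 1 / (R + 1)` for each level (`transports_erase`). A substitution is a deletion followed by an
insertion, so that the partition costs
`(exp η * (1 + 1 / (R + 1))) ^ L * exp η ^ L ≤ exp (2 * ε)`. The two leaves that change, by one entry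
each, cost `(2 ε, (1 + exp ε) δ)` by the privacy of `T`, applied to one copy at a time while all other
coins are regarded as a part of the adversary (`interaction_parallel_le`). As leaves change as
multisets, `T` is run on a random reordering of its data (`symmetrize`).

*Accuracy.* The start of a leaf deviates from its nominal place by a sum of at most `L` of the noise
variables (`deviation`). Bounding the moment generating function at `η / 2` yields a tail bound
for all `2 ^ L` leaves together (`noiseMean_deviation_tail`). The lower bound on `n` ensures that,
outside this tail, the leaves are disjoint, have at least `n'` entries, and are close enough to each
other (`exists_parameters`). The copies of `T` fail with total probability at most
`2 ^ L * (α * β / 8) ≤ β / 2`.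

For `1 / 2 ≤ α` or `k = 0` the constant answer `1 / 2` is accurate and no partition is needed. For
`k ≠ 0`, the interior point problem is unsolvable on the empty dataset, so that `n' ≥ 1`.
-/

/-! ### Probabilities in `ℝ` and in `ℝ≥0∞` -/

theorem measure_le_of_measureReal_le {Ω : Type*} [MeasurableSpace Ω] {μ ν : Measure Ω}
    [IsFiniteMeasure μ] [IsFiniteMeasure ν] {S : Set Ω} {c d : ℝ} (hc : 0 ≤ c) (hd : 0 ≤ d)
    (h : μ.real S ≤ c * ν.real S + d) : μ S ≤ ENNReal.ofReal c * ν S + ENNReal.ofReal d := by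
  rw [← ofReal_measureReal (μ := μ), ← ofReal_measureReal (μ := ν), ← ENNReal.ofReal_mul hc,
    ← ENNReal.ofReal_add (by positivity) hd]
  exact ENNReal.ofReal_le_ofReal h

theorem measureReal_le_of_measure_le {Ω : Type*} [MeasurableSpace Ω] {μ ν : Measure Ω}
    [IsFiniteMeasure μ] [IsFiniteMeasure ν] {S : Set Ω} {c d : ℝ} (hc : 0 ≤ c) (hd : 0 ≤ d)
    (h : μ S ≤ ENNReal.ofReal c * ν S + ENNReal.ofReal d) : μ.real S ≤ c * ν.real S + d := by
  rw [← ofReal_measureReal (μ := μ), ← ofReal_measureReal (μ := ν), ← ENNReal.ofReal_mul hc,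
    ← ENNReal.ofReal_add (by positivity) hd] at h
  exact (ENNReal.ofReal_le_ofReal_iff (by positivity)).1 h

theorem one_sub_le_measureReal_iff {Ω : Type*} [MeasurableSpace Ω] {μ : Measure Ω}
    [IsProbabilityMeasure μ] {S : Set Ω} (hS : MeasurableSet S) {c : ℝ} (hc : 0 ≤ c) :
    1 - c ≤ μ.real S ↔ μ Sᶜ ≤ ENNReal.ofReal c := by
  rw [← ofReal_measureReal (μ := μ) (s := Sᶜ), ENNReal.ofReal_le_ofReal_iff hc,
    probReal_compl_eq_one_sub hS]
  constructor <;> intro h <;> linarith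

/-- Resampling one coordinate of independent, identically distributed variables preserves their
joint law. -/
theorem measurePreserving_update_pi {m : ℕ} {C : Type*} [MeasurableSpace C] (μ : Measure C)
    [IsProbabilityMeasure μ] (i : Fin m) :
    MeasurePreserving (fun p : (Fin m → C) × C => Function.update p.1 i p.2)
      ((Measure.pi fun _ => μ).prod μ) (Measure.pi fun _ => μ) := by
  have hm : Measurable (fun p : (Fin m → C) × C => Function.update p.1 i p.2) := by
    refine measurable_pi_iff.2 fun l => ?_
    by_cases h : l = i
    · subst h; simpa using measurable_snd
    · simp only [Function.update_of_ne h]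
      fun_prop
  refine ⟨hm, ?_⟩
  refine (Measure.pi_eq fun s hs => ?_).symm
  rw [Measure.map_apply hm (MeasurableSet.univ_pi hs)]
  have : (fun p : (Fin m → C) × C => Function.update p.1 i p.2) ⁻¹' (Set.univ.pi s) =
      (Set.univ.pi (Function.update s i Set.univ)) ×ˢ s i := by
    ext p
    simp only [Set.mem_preimage, Set.mem_pi, Set.mem_univ, true_imp_iff, Set.mem_prod]
    constructor
    · intro h
      refine ⟨fun l => ?_, by simpa using h i⟩
      by_cases hl : l = i
      · subst hl; simp
      · simpa [Function.update_of_ne hl] using h l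
    · rintro ⟨h, h'⟩ l
      by_cases hl : l = i
      · subst hl; simpa using h'
      · simpa [Function.update_of_ne hl] using h l
  rw [this, Measure.prod_prod, Measure.pi_pi, ← Finset.prod_erase_mul _ _ (Finset.mem_univ i),
    ← Finset.prod_erase_mul Finset.univ (fun l => μ (s l)) (Finset.mem_univ i)]
  simp only [Function.update_self, measure_univ, mul_one]
  congr 1
  refine Finset.prod_congr rfl fun l hl => ?_
  rw [Function.update_of_ne (Finset.ne_of_mem_erase hl)]

/-! ### Randomized preprocessing and parallel copies of an interactive algorithm -/

namespace InteractiveAlgorithm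

variable {X Y Q R R' : Type} [MeasurableSpace Q] [MeasurableSpace R] [MeasurableSpace R']
  {n m : ℕ}

/-- The answers in a transcript are determined by its queries. -/
theorem transcript_snd_apply (M : InteractiveAlgorithm X Q R n) (A : Adversary Q R) (x : Fin n → X)
    (ω : M.Coins) (ω' : A.Coins) (k : ℕ) (j : Fin k) :
    (M.transcript A x ω ω' k).2 j = M.answer x ω j
      (fun l => (M.transcript A x ω ω' k).1 (Fin.castLE j.2 l)) := by
  induction k with
  | zero => exact j.elim0
  | succ k ih =>
    refine Fin.lastCases ?_ (fun j => ?_) j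
    · simp only [transcript, Fin.snoc_last]
      rfl
    · have h := ih j
      simp only [transcript, Fin.snoc_castSucc]
      rw [h]
      congr 1
      funext l
      have : (Fin.castLE j.castSucc.2 l : Fin (k + 1)) = (Fin.castLE j.2 l).castSucc := rfl
      rw [this, Fin.snoc_castSucc]

/-- Run `M` on the randomized dataset `D x b`, where `b` is drawn from `p` independently of the
coins of `M`. It is reducible so that its coins are seen to form a product space. -/
noncomputable abbrev preprocess (M : InteractiveAlgorithm Y Q R m) {N : Type} [MeasurableSpace N]
    [DiscreteMeasurableSpace N] [Countable N] (p : PMF N) (D : (Fin n → X) → N → Fin m → Y) :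
    InteractiveAlgorithm X Q R n where
  Coins := N × M.Coins
  law := p.toMeasure.prod M.law
  answer x ω j q := M.answer (D x ω.1) ω.2 j q
  measurable_answer x j := by
    have h : Measurable (fun r : N × (M.Coins × (Fin (j + 1) → Q)) =>
        M.answer (D x r.1) r.2.1 j r.2.2) :=
      measurable_from_prod_countable_right fun b => M.measurable_answer (D x b) j
    exact h.comp ((measurable_fst.comp measurable_fst).prodMk
      ((measurable_snd.comp measurable_fst).prodMk measurable_snd))

section preprocess

variable (M : InteractiveAlgorithm Y Q R m) {N : Type} [MeasurableSpace N]
    [DiscreteMeasurableSpace N] [Countable N] (p : PMF N) (D : (Fin n → X) → N → Fin m → Y)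

theorem transcript_preprocess (A : Adversary Q R) (x : Fin n → X) (ω : N × M.Coins)
    (ω' : A.Coins) (k : ℕ) :
    (M.preprocess p D).transcript A x ω ω' k = M.transcript A (D x ω.1) ω.2 ω' k := by
  induction k with
  | zero => rfl
  | succ k ih =>
    simp only [transcript, ih]

theorem interaction_preprocess_apply (A : Adversary Q R) (k : ℕ) (x : Fin n → X)
    {S : Set ((Fin k → Q) × (Fin k → R))} (hS : MeasurableSet S) :
    (M.preprocess p D).interaction A k x S = ∑' b, p b * M.interaction A k (D x b) S := by
  have hm := (M.preprocess p D).measurable_transcript A x k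
  unfold interaction
  rw [Measure.map_apply hm hS]
  have h1 : (M.preprocess p D).law.prod A.law = (p.toMeasure.prod M.law).prod A.law := rfl
  rw [h1]
  have h2 : MeasurableSet ((fun r : (N × M.Coins) × A.Coins =>
      (M.preprocess p D).transcript A x r.1 r.2 k) ⁻¹' S) := hm hS
  have h3 := (MeasureTheory.measurePreserving_prodAssoc p.toMeasure M.law A.law)
  have h4 : (fun r : (N × M.Coins) × A.Coins =>
      (M.preprocess p D).transcript A x r.1 r.2 k) ⁻¹' S =
      MeasurableEquiv.prodAssoc ⁻¹' {r : N × (M.Coins × A.Coins) |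
        M.transcript A (D x r.1) r.2.1 r.2.2 k ∈ S} := by
    ext r
    simp only [Set.mem_preimage, transcript_preprocess]
    rfl
  have h5 : MeasurableSet {r : N × (M.Coins × A.Coins) |
        M.transcript A (D x r.1) r.2.1 r.2.2 k ∈ S} := by
    have : Measurable (fun r : N × (M.Coins × A.Coins) =>
        M.transcript A (D x r.1) r.2.1 r.2.2 k) :=
      measurable_from_prod_countable_right fun b => M.measurable_transcript A (D x b) k
    exact this hS
  rw [h4, h3.measure_preimage h5.nullMeasurableSet, Measure.prod_apply h5, lintegral_countable']
  refine tsum_congr fun b => ?_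
  rw [PMF.toMeasure_apply_singleton _ _ (measurableSet_singleton b), mul_comm,
    Measure.map_apply (M.measurable_transcript A (D x b) k) hS]
  rfl

end preprocess

/-- `m` independent copies of `T`, each on its own dataset, that receive the same queries and whose
answers are aggregated by `f`. The tuple of the `m` datasets is regarded as a single dataset. -/
noncomputable abbrev parallel (T : InteractiveAlgorithm X Q R n) {f : (Fin m → R) → R'}
    (hf : Measurable f) : InteractiveAlgorithm (Fin n → X) Q R' m where
  Coins := Fin m → T.Coins
  law := Measure.pi fun _ => T.law
  answer D ω j q := f fun i => T.answer (D i) (ω i) j q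
  measurable_answer D j := hf.comp (measurable_pi_lambda _ fun i =>
    (T.measurable_answer (D i) j).comp (g := fun r => T.answer (D i) r.1 j r.2)
      (((measurable_pi_apply (X := fun _ => T.Coins) i).comp measurable_fst).prodMk measurable_snd))

section parallel

variable (T : InteractiveAlgorithm X Q R n) {f : (Fin m → R) → R'} (hf : Measurable f)
  (A : Adversary Q R') (D : Fin m → Fin n → X) (i₀ : Fin m) (ω : Fin m → T.Coins) (ω' : A.Coins)

/-- The first `j` rounds of the interaction of `A` with parallel copies of `T`, as a function of the
answers `a` of the copy `i₀`, for fixed coins of `A` and of the other copies. The dataset and the coins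
of the copy `i₀` itself do not matter. -/
def simulate (f : (Fin m → R) → R') (A : Adversary Q R') (ω' : A.Coins) :
    (j : ℕ) → (Fin j → R) → (Fin j → Q) × (Fin j → R')
  | 0, _ => (Fin.elim0, Fin.elim0)
  | j + 1, a =>
    let h := simulate f A ω' j (fun l => a l.castSucc)
    let q : Fin (j + 1) → Q := Fin.snoc (α := fun _ => Q) h.1 (A.query ω' j h.2)
    (q, Fin.snoc (α := fun _ => R') h.2
      (f (Function.update (fun i => T.answer (D i) (ω i) j q) i₀ (a (Fin.last j)))))

include hf in
theorem measurable_simulate (j : ℕ) : Measurable (simulate T D i₀ ω f A ω' j) := by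
  induction j with
  | zero => exact measurable_const
  | succ j ih =>
    have ih' : Measurable fun a : Fin (j + 1) → R =>
        simulate T D i₀ ω f A ω' j (fun l => a l.castSucc) :=
      ih.comp (measurable_pi_lambda _ fun l => measurable_pi_apply _)
    have hq := measurable_snoc_const ih'.fst
      ((A.measurable_query j).comp (measurable_const.prodMk ih'.snd) : Measurable
        fun a : Fin (j + 1) → R =>
          A.query ω' j (simulate T D i₀ ω f A ω' j (fun l => a l.castSucc)).2)
    refine hq.prodMk (measurable_snoc_const ih'.snd (hf.comp (measurable_pi_iff.2 fun i => ?_)))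
    by_cases h : i = i₀
    · subst h
      simpa using measurable_pi_apply _
    · simp only [Function.update_of_ne h]
      exact (T.measurable_answer (D i) j).comp (measurable_const.prodMk hq)

/-- The adversary against the copy `i₀` of `T` that arises from an adversary against parallel copies
of `T` once all the other coins are fixed. -/
noncomputable abbrev simulator : Adversary Q R where
  Coins := Unit
  law := Measure.dirac ()
  query _ j a := A.query ω' j (simulate T D i₀ ω f A ω' j a).2
  measurable_query j := (A.measurable_query j).comp (measurable_const.prodMk
    ((measurable_simulate T hf A D i₀ ω ω' j).snd.comp measurable_snd))

/-- The interaction of `A` with all the copies can be read off from the interaction of `simulator`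
with the copy `i₀`. -/
theorem simulate_transcript (y : Fin n → X) (c : T.Coins) (k : ℕ) :
    simulate T D i₀ ω f A ω' k (T.transcript (simulator T hf A D i₀ ω ω') y c () k).2 =
      (T.parallel hf).transcript A (Function.update D i₀ y) (Function.update ω i₀ c) ω' k ∧
    ((T.parallel hf).transcript A (Function.update D i₀ y) (Function.update ω i₀ c) ω' k).1 =
      (T.transcript (simulator T hf A D i₀ ω ω') y c () k).1 := by
  induction k with
  | zero => exact ⟨rfl, rfl⟩
  | succ k ih =>
    obtain ⟨h1, h2⟩ := ih
    have hu : ∀ q, Function.update (fun i => T.answer (D i) (ω i) k q) i₀ (T.answer y c k q) =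
        fun i => T.answer (Function.update D i₀ y i) (Function.update ω i₀ c i) k q := by
      intro q
      funext i
      by_cases h : i = i₀
      · subst h; simp
      · simp [Function.update_of_ne h]
    constructor
    · simp only [transcript, simulate, Fin.snoc_castSucc, Fin.snoc_last, h1, h2]
      rw [← h2, hu]
    · simp only [transcript, h1, h2]

theorem interaction_simulator_apply (k : ℕ) (y : Fin n → X)
    {S : Set ((Fin k → Q) × (Fin k → R))} (hS : MeasurableSet S) :
    T.interaction (simulator T hf A D i₀ ω ω') k y S =
      T.law {c | T.transcript (simulator T hf A D i₀ ω ω') y c () k ∈ S} := by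
  unfold interaction
  have : (simulator T hf A D i₀ ω ω').law = Measure.dirac () := rfl
  rw [this, Measure.prod_dirac, Measure.map_map (T.measurable_transcript _ y k) (by fun_prop),
    Measure.map_apply ((T.measurable_transcript _ y k).comp (by fun_prop)) hS]
  rfl

/-- Fubini's theorem for the coins of one copy. -/
theorem measure_eq_lintegral_update {V : Set ((Fin m → T.Coins) × A.Coins)}
    (hV : MeasurableSet V) :
    ((Measure.pi fun _ => T.law).prod A.law) V =
      ∫⁻ ω', ∫⁻ ω, T.law {c | (Function.update ω i₀ c, ω') ∈ V}
        ∂(Measure.pi fun _ => T.law) ∂A.law := by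
  rw [Measure.prod_apply_symm hV]
  refine lintegral_congr fun ω' => ?_
  have h := measurePreserving_update_pi T.law i₀
  have hV' : MeasurableSet ((fun ω => (ω, ω')) ⁻¹' V) := measurable_prodMk_right hV
  rw [← h.measure_preimage hV'.nullMeasurableSet, Measure.prod_apply (h.measurable hV')]
  rfl

/-- Parallel composition: if `T` does not distinguish `y` from `y'` by more than `(c, d)`, then
neither do parallel copies of `T` when `y` and `y'` are the dataset of one of the copies. -/
theorem interaction_parallel_le {k : ℕ} {y y' : Fin n → X} {c d : ENNReal}
    (hc : c ≠ ⊤) (h : ∀ (A : Adversary Q R) (S : Set ((Fin k → Q) × (Fin k → R))), MeasurableSet S →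
      T.interaction A k y S ≤ c * T.interaction A k y' S + d)
    {S : Set ((Fin k → Q) × (Fin k → R'))} (hS : MeasurableSet S) :
    (T.parallel hf).interaction A k (Function.update D i₀ y) S ≤
      c * (T.parallel hf).interaction A k (Function.update D i₀ y') S + d := by
  have key : ∀ y : Fin n → X, (T.parallel hf).interaction A k (Function.update D i₀ y) S =
      ∫⁻ ω', ∫⁻ ω, T.interaction (simulator T hf A D i₀ ω ω') k y
        {t | simulate T D i₀ ω f A ω' k t.2 ∈ S} ∂(Measure.pi fun _ => T.law) ∂A.law := by
    intro y
    have hm := (T.parallel hf).measurable_transcript A (Function.update D i₀ y) k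
    unfold interaction
    rw [Measure.map_apply hm hS]
    refine (measure_eq_lintegral_update T A i₀ (hm hS)).trans ?_
    refine lintegral_congr fun ω' => lintegral_congr fun ω => ?_
    have := interaction_simulator_apply T hf A D i₀ ω ω' k y
      (S := {t | simulate T D i₀ ω f A ω' k t.2 ∈ S})
      ((measurable_simulate T hf A D i₀ ω ω' k).comp measurable_snd hS)
    unfold interaction at this
    rw [this]
    congr 1
    ext c
    simp only [Set.mem_preimage, Set.mem_ofPred_eq, (simulate_transcript T hf A D i₀ ω ω' y c k).1]
  rw [key, key]
  calc _ ≤ ∫⁻ ω', ∫⁻ ω, (c * T.interaction (simulator T hf A D i₀ ω ω') k y'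
        {t | simulate T D i₀ ω f A ω' k t.2 ∈ S} + d) ∂(Measure.pi fun _ => T.law) ∂A.law :=
        lintegral_mono fun ω' => lintegral_mono fun ω => h _ _
          ((measurable_simulate T hf A D i₀ ω ω' k).comp measurable_snd hS)
    _ = ∫⁻ ω', ((∫⁻ ω, c * T.interaction (simulator T hf A D i₀ ω ω') k y'
        {t | simulate T D i₀ ω f A ω' k t.2 ∈ S} ∂(Measure.pi fun _ => T.law)) + d) ∂A.law := by
        refine lintegral_congr fun ω' => ?_
        rw [lintegral_add_right _ measurable_const]
        simp
    _ = _ := by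
        rw [lintegral_add_right _ measurable_const]
        simp only [lintegral_const, measure_univ, mul_one, lintegral_const_mul' _ _ hc]

/-- If `T` has a transcript in `G` with probability at most `c` against every adversary, then so has
each of the parallel copies of `T`. The transcript of a copy consists of the common queries and of
its own answers, which are not visible in the transcript of the parallel algorithm. -/
theorem measure_copy_le {k : ℕ} {G : Set ((Fin k → Q) × (Fin k → R))} (hG : MeasurableSet G)
    {c : ENNReal} (h : ∀ A : Adversary Q R, T.interaction A k (D i₀) G ≤ c) :
    ((Measure.pi fun _ => T.law).prod A.law) {p | (((T.parallel hf).transcript A D p.1 p.2 k).1,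
      fun j : Fin k => T.answer (D i₀) (p.1 i₀) j fun l =>
        ((T.parallel hf).transcript A D p.1 p.2 k).1 (Fin.castLE j.2 l)) ∈ G} ≤ c := by
  have hm := (T.parallel hf).measurable_transcript A D k
  have hV : MeasurableSet {p : (Fin m → T.Coins) × A.Coins |
      (((T.parallel hf).transcript A D p.1 p.2 k).1,
      fun j : Fin k => T.answer (D i₀) (p.1 i₀) j fun l =>
        ((T.parallel hf).transcript A D p.1 p.2 k).1 (Fin.castLE j.2 l)) ∈ G} := by
    refine (Measurable.prodMk hm.fst (measurable_pi_lambda _ fun j => ?_)) hG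
    exact (T.measurable_answer (D i₀) j).comp
      (((measurable_pi_apply i₀).comp measurable_fst).prodMk
        (measurable_pi_lambda _ fun l => (measurable_pi_apply _).comp hm.fst))
  rw [measure_eq_lintegral_update T A i₀ hV]
  have : ∀ ω' ω, T.law {c | (Function.update ω i₀ c, ω') ∈ {p : (Fin m → T.Coins) × A.Coins |
      (((T.parallel hf).transcript A D p.1 p.2 k).1,
      fun j : Fin k => T.answer (D i₀) (p.1 i₀) j fun l =>
        ((T.parallel hf).transcript A D p.1 p.2 k).1 (Fin.castLE j.2 l)) ∈ G}} ≤ c := by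
    intro ω' ω
    refine le_trans (le_of_eq ?_) (h (simulator T hf A D i₀ ω ω'))
    rw [interaction_simulator_apply T hf A D i₀ ω ω' k (D i₀) hG]
    congr 1
    ext c
    have h2 := (simulate_transcript T hf A D i₀ ω ω' (D i₀) c k).2
    rw [Function.update_eq_self] at h2
    simp only [Set.mem_ofPred_eq, Function.update_self, h2]
    have h3 : (fun j : Fin k => T.answer (D i₀) c j fun l =>
        (T.transcript (simulator T hf A D i₀ ω ω') (D i₀) c () k).1 (Fin.castLE j.2 l)) =
        (T.transcript (simulator T hf A D i₀ ω ω') (D i₀) c () k).2 := by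
      funext j
      exact (T.transcript_snd_apply _ _ _ _ _ _).symm
    rw [h3]
  calc _ ≤ ∫⁻ ω', ∫⁻ ω, c ∂(Measure.pi fun _ => T.law) ∂A.law :=
        lintegral_mono fun ω' => lintegral_mono fun ω => this ω' ω
    _ = c := by simp

end parallel

end InteractiveAlgorithm

/-! ### The discrete Laplace law -/

/-- The two-sided geometric (discrete Laplace) weights on `ℤ` with ratio `q`. -/
noncomputable def laplaceWeight (q : ℝ) (z : ℤ) : ENNReal :=
  ENNReal.ofReal ((1 - q) / (1 + q) * q ^ z.natAbs)

theorem laplaceWeight_le_mul {q : ℝ} (hq : 0 < q) (hq1 : q < 1) {z z' : ℤ}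
    (h : z'.natAbs ≤ z.natAbs + 1) :
    laplaceWeight q z ≤ ENNReal.ofReal q⁻¹ * laplaceWeight q z' := by
  unfold laplaceWeight
  rw [← ENNReal.ofReal_mul (by positivity)]
  refine ENNReal.ofReal_le_ofReal ?_
  have h1 : 0 ≤ (1 - q) / (1 + q) := div_nonneg (by linarith) (by linarith)
  have h2 : q ^ (z.natAbs + 1) ≤ q ^ z'.natAbs := pow_le_pow_of_le_one hq.le hq1.le h
  calc (1 - q) / (1 + q) * q ^ z.natAbs = q⁻¹ * ((1 - q) / (1 + q) * q ^ (z.natAbs + 1)) := by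
        rw [pow_succ]; field_simp
    _ ≤ _ := by gcongr

/-- The moment generating function of the discrete Laplace law of ratio `a ^ 2`. -/
theorem hasSum_laplace_mgf {a r : ℝ} (hr : 0 < r) (h1 : a ^ 2 * r < 1)
    (h2 : a ^ 2 * r⁻¹ < 1) :
    HasSum (fun z : ℤ => (1 - a ^ 2) / (1 + a ^ 2) * (a ^ 2) ^ z.natAbs * r ^ z)
      ((1 - a ^ 2) / (1 + a ^ 2) *
        ((1 - a ^ 2 * r)⁻¹ + a ^ 2 * r⁻¹ * (1 - a ^ 2 * r⁻¹)⁻¹)) := by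
  have hp := hasSum_geometric_of_lt_one (by positivity : 0 ≤ a ^ 2 * r) h1
  have hn := (hasSum_geometric_of_lt_one (by positivity : 0 ≤ a ^ 2 * r⁻¹) h2).mul_left
    (a ^ 2 * r⁻¹)
  have := HasSum.of_nat_of_neg_add_one (f := fun z : ℤ => (a ^ 2) ^ z.natAbs * r ^ z)
    (by simpa [mul_pow] using hp) (by
      have e : (fun k : ℕ => (a ^ 2) ^ (-((k : ℤ) + 1)).natAbs * r ^ (-((k : ℤ) + 1))) =
          fun k : ℕ => a ^ 2 * r⁻¹ * (a ^ 2 * r⁻¹) ^ k := by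
        funext k
        have : (-((k : ℤ) + 1)).natAbs = k + 1 := by omega
        rw [this, zpow_neg, ← Nat.cast_succ, zpow_natCast, ← inv_pow, ← mul_pow, pow_succ']
      rw [e]
      exact hn)
  simpa only [mul_assoc] using this.mul_left ((1 - a ^ 2) / (1 + a ^ 2))

theorem tsum_laplaceWeight {q : ℝ} (hq : 0 < q) (hq1 : q < 1) : ∑' z, laplaceWeight q z = 1 := by
  have hs : (Real.sqrt q) ^ 2 = q := Real.sq_sqrt hq.le
  have h := hasSum_laplace_mgf (a := Real.sqrt q) (r := 1) one_pos (by simpa [hs]) (by simpa [hs])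
  rw [hs] at h
  simp only [one_zpow, mul_one, inv_one] at h
  have h1 : 0 ≤ (1 - q) / (1 + q) := div_nonneg (by linarith) (by linarith)
  unfold laplaceWeight
  rw [← ENNReal.ofReal_tsum_of_nonneg (fun z => by positivity) h.summable, h.tsum_eq]
  rw [ENNReal.ofReal_eq_one]
  have : 1 - q ≠ 0 := by linarith
  field_simp

/-- At half of its rate, the moment generating function of the discrete Laplace law is at most
`4 / 3`, as it is for the continuous one. -/
theorem tsum_laplaceWeight_mul_exp_le {η s : ℝ} (hη : 0 < η) (hs : s = 1 ∨ s = -1) :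
    ∑' z : ℤ, laplaceWeight (Real.exp (-η)) z * ENNReal.ofReal (Real.exp (s * (η / 2) * z)) ≤
      ENNReal.ofReal (4 / 3) := by
  set a := Real.exp (-(η / 2)) with ha
  have ha0 : 0 < a := Real.exp_pos _
  have ha1 : a < 1 := by rw [ha, Real.exp_lt_one_iff]; linarith
  have hq : Real.exp (-η) = a ^ 2 := by rw [ha, ← Real.exp_nat_mul]; congr 1; push_cast; ring
  have hr : ∃ r : ℝ, (r = a ∨ r = a⁻¹) ∧ ∀ z : ℤ, Real.exp (s * (η / 2) * z) = r ^ z := by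
    rcases hs with rfl | rfl
    · refine ⟨a⁻¹, Or.inr rfl, fun z => ?_⟩
      rw [ha, ← Real.exp_neg, ← Real.rpow_intCast, ← Real.exp_mul]; congr 1; ring
    · refine ⟨a, Or.inl rfl, fun z => ?_⟩
      rw [ha, ← Real.rpow_intCast, ← Real.exp_mul]; congr 1; ring
  obtain ⟨r, hr, hz⟩ := hr
  have hr0 : 0 < r := by rcases hr with rfl | rfl <;> positivity
  have ha3 : a ^ 3 < 1 := pow_lt_one₀ ha0.le ha1 (by norm_num)
  have e1 : a ^ 2 * a⁻¹ = a := by field_simp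
  have e2 : a ^ 2 * a = a ^ 3 := by ring
  have h := hasSum_laplace_mgf hr0
    (by rcases hr with rfl | rfl; · rwa [e2]
        · rwa [e1])
    (by rcases hr with rfl | rfl; · rwa [e1]
        · rwa [inv_inv, e2])
  have h1 : 0 ≤ (1 - a ^ 2) / (1 + a ^ 2) := div_nonneg (by nlinarith) (by positivity)
  have : ∀ z : ℤ, laplaceWeight (Real.exp (-η)) z * ENNReal.ofReal (Real.exp (s * (η / 2) * z)) =
      ENNReal.ofReal ((1 - a ^ 2) / (1 + a ^ 2) * (a ^ 2) ^ z.natAbs * r ^ z) := by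
    intro z
    rw [laplaceWeight, hq, hz, ← ENNReal.ofReal_mul (by positivity)]
  simp only [this]
  rw [← ENNReal.ofReal_tsum_of_nonneg (fun z => by positivity) h.summable, h.tsum_eq]
  refine ENNReal.ofReal_le_ofReal ?_
  have n1 : (1 - a) ≠ 0 := by linarith
  have n3 : (1 - a ^ 3) ≠ 0 := by linarith
  have hv : (1 - a ^ 2) / (1 + a ^ 2) *
        ((1 - a ^ 2 * r)⁻¹ + a ^ 2 * r⁻¹ * (1 - a ^ 2 * r⁻¹)⁻¹) =
        (1 + a) ^ 2 / (1 + a + a ^ 2) := by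
    have h3 : (1 - a ^ 3) = (1 - a) * (1 + a + a ^ 2) := by ring
    have n4 : 1 + a + a ^ 2 ≠ 0 := by positivity
    rcases hr with rfl | rfl
    · rw [e1, e2, h3]; field_simp; ring
    · rw [inv_inv, e1, e2, h3]; field_simp; ring
  rw [hv, div_le_div_iff₀ (by positivity) (by norm_num)]
  nlinarith [sq_nonneg (1 - a)]

/-! ### Independent noise on a binary tree -/

/-- Integer labellings of the inner nodes of the complete binary tree of height `h`. -/
def Noise : ℕ → Type
  | 0 => Unit
  | h + 1 => ℤ × Noise h × Noise h

instance (h : ℕ) : MeasurableSpace (Noise h) := ⊤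

instance (h : ℕ) : DiscreteMeasurableSpace (Noise h) := ⟨fun _ => trivial⟩

instance Noise.countable (h : ℕ) : Countable (Noise h) := by
  induction h with
  | zero => exact inferInstanceAs (Countable Unit)
  | succ h ih => exact inferInstanceAs (Countable (ℤ × Noise h × Noise h))

/-- The weight of a labelling for the law of independent labels of weight `w`. -/
noncomputable def noiseWeight (w : ℤ → ENNReal) : (h : ℕ) → Noise h → ENNReal
  | 0, _ => 1
  | h + 1, (z, b) => w z * (noiseWeight w h b.1 * noiseWeight w h b.2)

/-- The expected value of `F` under independent labels of weight `w`. -/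
noncomputable def noiseMean (w : ℤ → ENNReal) (h : ℕ) (F : Noise h → ENNReal) : ENNReal :=
  ∑' b, noiseWeight w h b * F b

theorem noiseMean_succ (w : ℤ → ENNReal) (h : ℕ) (F : Noise (h + 1) → ENNReal) :
    noiseMean w (h + 1) F =
      ∑' z, w z * noiseMean w h fun l => noiseMean w h fun r => F (z, l, r) := by
  unfold noiseMean
  refine (ENNReal.tsum_prod' (f := fun b : ℤ × Noise h × Noise h =>
    noiseWeight w (h + 1) b * F b)).trans (tsum_congr fun z => ?_)
  rw [ENNReal.tsum_prod', ← ENNReal.tsum_mul_left]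
  refine tsum_congr fun l => ?_
  rw [← ENNReal.tsum_mul_left, ← ENNReal.tsum_mul_left]
  refine tsum_congr fun r => ?_
  simp only [noiseWeight]
  ring

theorem noiseMean_zero (w : ℤ → ENNReal) (F : Noise 0 → ENNReal) : noiseMean w 0 F = F () := by
  change ∑' b : Unit, noiseWeight w 0 b * F b = F ()
  rw [tsum_fintype]
  exact (Finset.sum_singleton _ _).trans (one_mul _)

theorem noiseMean_mono {w : ℤ → ENNReal} {h : ℕ} {F G : Noise h → ENNReal} (hFG : ∀ b, F b ≤ G b) :
    noiseMean w h F ≤ noiseMean w h G :=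
  ENNReal.tsum_le_tsum fun b => by gcongr; exact hFG b

theorem noiseMean_mul_left (w : ℤ → ENNReal) (h : ℕ) (c : ENNReal) (F : Noise h → ENNReal) :
    noiseMean w h (fun b => c * F b) = c * noiseMean w h F := by
  unfold noiseMean
  rw [← ENNReal.tsum_mul_left]
  exact tsum_congr fun b => by ring

theorem noiseMean_add (w : ℤ → ENNReal) (h : ℕ) (F G : Noise h → ENNReal) :
    noiseMean w h (fun b => F b + G b) = noiseMean w h F + noiseMean w h G := by
  unfold noiseMean
  rw [← ENNReal.tsum_add]
  exact tsum_congr fun b => by ring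

theorem noiseMean_one {w : ℤ → ENNReal} (hw : ∑' z, w z = 1) (h : ℕ) :
    noiseMean w h (fun _ => 1) = 1 := by
  induction h with
  | zero => rw [noiseMean_zero]
  | succ h ih => simp only [noiseMean_succ, ih, mul_one, hw]

theorem noiseMean_const {w : ℤ → ENNReal} (hw : ∑' z, w z = 1) (h : ℕ) (c : ENNReal) :
    noiseMean w h (fun _ => c) = c := by
  simpa [noiseMean_one hw] using noiseMean_mul_left w h c (fun _ => 1)

/-- The law of independent labels of weight `w`. -/
noncomputable def noisePMF {w : ℤ → ENNReal} (hw : ∑' z, w z = 1) (h : ℕ) : PMF (Noise h) :=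
  ⟨noiseWeight w h, by
    have := noiseMean_one hw h
    simp only [noiseMean, mul_one] at this
    exact this ▸ ENNReal.summable.hasSum⟩

/-! ### Random partitions of a list -/

/-- The partition of `l` into `2 ^ h` leaves that is given by the noise `b` on the complete binary tree
of height `h`. The leaves have the numbers `j, …, j + 2 ^ h - 1` among all the leaves, and `π i` is the
nominal start of leaf `i` in the whole list. The root cuts `l` at its nominal place
`π (j + 2 ^ h) - π j` plus its noise; the `R` entries before the cut are discarded. The value at
`i < 2 ^ h` is leaf `j + i`. -/
def leaves (π : ℕ → ℤ) (R : ℕ) : (h j : ℕ) → List I → Noise h → ℕ → List I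
  | 0, _, l, _ => fun i => if i = 0 then l else []
  | h + 1, j, l, (z, b) => fun i =>
    if i < 2 ^ h then
      leaves π R h j (l.take (z + (π (j + 2 ^ h) - π j) - R).toNat) b.1 i
    else leaves π R h (j + 2 ^ h) (l.drop (z + (π (j + 2 ^ h) - π j)).toNat) b.2 (i - 2 ^ h)

/-- The list families `D` and `D'` agree except at one index, where they are related by `r`. The
families also agree everywhere if `r` relates the lists at that index to themselves. -/
def RelAtOne (r : List I → List I → Prop) (D D' : ℕ → List I) : Prop :=
  ∃ i, r (D i) (D' i) ∧ ∀ l, l ≠ i → D l = D' l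

/-- `D` on the indices below `m`, followed by `E`. -/
def appendAt (m : ℕ) (D E : ℕ → List I) : ℕ → List I := fun i => if i < m then D i else E (i - m)

theorem RelAtOne.appendAt_left {r : List I → List I → Prop} (hr : ∀ l, r l l) {D D' : ℕ → List I}
    (h : RelAtOne r D D') (m : ℕ) (E : ℕ → List I) :
    RelAtOne r (appendAt m D E) (appendAt m D' E) := by
  obtain ⟨i, hi, hl⟩ := h
  refine ⟨i, ?_, fun l hli => ?_⟩
  · by_cases h : i < m <;> simp [appendAt, h, hi, hr]
  · simp [appendAt, hl l hli]

theorem RelAtOne.appendAt_right {r : List I → List I → Prop} {D D' : ℕ → List I}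
    (h : RelAtOne r D D') (m : ℕ) (E : ℕ → List I) :
    RelAtOne r (appendAt m E D) (appendAt m E D') := by
  obtain ⟨i, hi, hl⟩ := h
  refine ⟨i + m, by simpa [appendAt] using hi, fun l hli => ?_⟩
  by_cases h : l < m
  · simp [appendAt, h]
  · simp [appendAt, h, hl (l - m) (by omega)]

theorem leaves_succ (π : ℕ → ℤ) (R h j : ℕ) (l : List I) (z : ℤ) (b b' : Noise h) :
    leaves π R (h + 1) j l (z, b, b') = appendAt (2 ^ h)
      (leaves π R h j (l.take (z + (π (j + 2 ^ h) - π j) - R).toNat) b)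
      (leaves π R h (j + 2 ^ h) (l.drop (z + (π (j + 2 ^ h) - π j)).toNat) b') := rfl

/-- The random partitions into `2 ^ h` leaves of two lists related by `r` can be coupled such that the
leaves are related by `RelAtOne r`, up to a factor `c` in the probabilities. This is expressed through
the means of pairs of functions that are ordered on related families. -/
def Transports (w : ℤ → ENNReal) (π : ℕ → ℤ) (R : ℕ) (r : List I → List I → Prop) (h : ℕ)
    (c : ENNReal) : Prop :=
  ∀ (j : ℕ) (l l' : List I), r l l' → ∀ F G : (ℕ → List I) → ENNReal,
    (∀ D D', RelAtOne r D D' → F D ≤ G D') →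
    noiseMean w h (fun b => F (leaves π R h j l b)) ≤
      c * noiseMean w h (fun b => G (leaves π R h j l' b))

/-- The mean of `F` over the partitions that split into `l` and `l'` at the root. -/
noncomputable def nodeMean (w : ℤ → ENNReal) (π : ℕ → ℤ) (R h j : ℕ) (F : (ℕ → List I) → ENNReal)
    (l l' : List I) : ENNReal :=
  noiseMean w h fun b => noiseMean w h fun b' =>
    F (appendAt (2 ^ h) (leaves π R h j l b) (leaves π R h (j + 2 ^ h) l' b'))

theorem noiseMean_leaves_succ (w : ℤ → ENNReal) (π : ℕ → ℤ) (R h j : ℕ)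
    (F : (ℕ → List I) → ENNReal) (l : List I) :
    noiseMean w (h + 1) (fun b => F (leaves π R (h + 1) j l b)) =
      ∑' z, w z * nodeMean w π R h j F (l.take (z + (π (j + 2 ^ h) - π j) - R).toNat)
        (l.drop (z + (π (j + 2 ^ h) - π j)).toNat) :=
  noiseMean_succ _ _ _

section

variable {w : ℤ → ENNReal} {π : ℕ → ℤ} {R h : ℕ} {r : List I → List I → Prop} {c : ENNReal}
  {F G : (ℕ → List I) → ENNReal}

theorem Transports.nodeMean_left (hT : Transports w π R r h c) (hr : ∀ l, r l l)
    (hFG : ∀ D D', RelAtOne r D D' → F D ≤ G D') (j : ℕ) {l₁ l₁' l₂ : List I} (hl : r l₁ l₁') :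
    nodeMean w π R h j F l₁ l₂ ≤ c * nodeMean w π R h j G l₁' l₂ :=
  hT j l₁ l₁' hl
    (fun D => noiseMean w h fun b' => F (appendAt (2 ^ h) D (leaves π R h (j + 2 ^ h) l₂ b')))
    (fun D => noiseMean w h fun b' => G (appendAt (2 ^ h) D (leaves π R h (j + 2 ^ h) l₂ b')))
    fun _ _ hD => noiseMean_mono fun _ => hFG _ _ (hD.appendAt_left hr _ _)

theorem Transports.nodeMean_right (hT : Transports w π R r h c)
    (hFG : ∀ D D', RelAtOne r D D' → F D ≤ G D') (j : ℕ) {l₁ l₂ l₂' : List I} (hl : r l₂ l₂') :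
    nodeMean w π R h j F l₁ l₂ ≤ c * nodeMean w π R h j G l₁ l₂' := by
  unfold nodeMean
  rw [← noiseMean_mul_left]
  exact noiseMean_mono fun b => hT (j + 2 ^ h) l₂ l₂' hl
    (fun D => F (appendAt (2 ^ h) (leaves π R h j l₁ b) D))
    (fun D => G (appendAt (2 ^ h) (leaves π R h j l₁ b) D))
    fun _ _ hD => hFG _ _ (hD.appendAt_right _ _)

end

/-- If the erased entry lies before the cut, then moving the cut one place back keeps the right part and
erases at most one entry of the left part. -/
theorem eraseIdx_cut_shift (l : List I) {p : ℕ} {c : ℤ} (R : ℕ) (hp : (p : ℤ) < c) :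
    (l.eraseIdx p).drop (c - 1).toNat = l.drop c.toNat ∧
      ∃ p', (l.eraseIdx p).take (c - 1 - R).toNat = (l.take (c - R).toNat).eraseIdx p' := by
  constructor
  · refine List.ext_getElem? fun i => ?_
    rw [List.getElem?_drop, List.getElem?_drop, List.getElem?_eraseIdx, if_neg (by omega)]
    congr 1
    omega
  · refine ⟨min p (c - 1 - R).toNat, List.ext_getElem? fun i => ?_⟩
    simp only [List.getElem?_eraseIdx, List.getElem?_take]
    split_ifs <;> first | rfl | omega

/-- If the erased entry lies in the gap or behind it, then keeping the cut keeps the left part and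
erases at most one entry of the right part. -/
theorem eraseIdx_cut_stay (l : List I) {p : ℕ} {c : ℤ} {R : ℕ} (hp : c - R ≤ (p : ℤ)) :
    (l.eraseIdx p).take (c - R).toNat = l.take (c - R).toNat ∧
      ∃ p', (l.eraseIdx p).drop c.toNat = (l.drop c.toNat).eraseIdx p' := by
  constructor
  · refine List.ext_getElem? fun i => ?_
    simp only [List.getElem?_eraseIdx, List.getElem?_take]
    split_ifs <;> first | rfl | omega
  · refine ⟨p - c.toNat, List.ext_getElem? fun i => ?_⟩
    simp only [List.getElem?_eraseIdx, List.getElem?_drop]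
    split_ifs <;> first | rfl | omega

/-- The probability with which a cut follows the deletion of the entry at position `g` of its gap;
it decreases from `1` before the gap to `0` behind it, in steps of at most `1 / (R + 1)`. -/
noncomputable def shiftProb (R : ℕ) (g : ℤ) : ℝ := max 0 (min 1 (1 - (g + 1) / (R + 1)))

theorem shiftProb_of_neg (R : ℕ) {g : ℤ} (hg : g < 0) : shiftProb R g = 1 := by
  have h : ((g : ℝ) + 1) ≤ 0 := by exact_mod_cast hg
  have : ((g : ℝ) + 1) / (R + 1) ≤ 0 := div_nonpos_of_nonpos_of_nonneg h (by positivity)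
  rw [shiftProb, min_eq_left (by linarith)]
  simp

theorem shiftProb_of_le {R : ℕ} {g : ℤ} (hg : (R : ℤ) ≤ g) : shiftProb R g = 0 := by
  have h : (R : ℝ) ≤ g := by exact_mod_cast hg
  have : 1 ≤ ((g : ℝ) + 1) / (R + 1) := by rw [le_div_iff₀ (by positivity)]; linarith
  rw [shiftProb, max_eq_left]
  exact (min_le_right _ _).trans (by linarith)

theorem shiftProb_nonneg (R : ℕ) (g : ℤ) : 0 ≤ shiftProb R g := le_max_left _ _

theorem shiftProb_le_one (R : ℕ) (g : ℤ) : shiftProb R g ≤ 1 :=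
  max_le zero_le_one (min_le_left _ _)

theorem shiftProb_sub_one_le (R : ℕ) (g : ℤ) :
    shiftProb R (g - 1) ≤ shiftProb R g + 1 / (R + 1) := by
  have h : (0 : ℝ) < 1 / (R + 1) := by positivity
  have e : 1 - (((g - 1 : ℤ) : ℝ) + 1) / (R + 1) = 1 - ((g : ℝ) + 1) / (R + 1) + 1 / (R + 1) := by
    push_cast; field_simp; ring
  unfold shiftProb
  rw [e]
  refine max_le (by positivity) ?_
  rcases le_total 1 (1 - ((g : ℝ) + 1) / (R + 1)) with h1 | h1
  · rw [min_eq_left h1]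
    exact (min_le_left _ _).trans (by rw [max_eq_right zero_le_one]; linarith)
  · rw [min_eq_right h1]
    exact (min_le_right _ _).trans (by gcongr; exact le_max_right _ _)

/-- Cost of a deletion. With the cut at `z`, the partition of `l` is compared with a mixture of the
partitions of `l.eraseIdx p` with cuts at `z - 1` and at `z`; in turn, a cut of the latter list at `z`
is used for cuts of `l` at `z + 1` and at `z`, with weights that add up to at most
`1 + 1 / (R + 1)`. -/
theorem transports_erase {q : ℝ} (hq : 0 < q) (hq1 : q < 1) (π : ℕ → ℤ) (R h : ℕ) :
    Transports (laplaceWeight q) π R (fun l l' => ∃ p, l' = l.eraseIdx p) h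
      (ENNReal.ofReal (q⁻¹ * (1 + 1 / (R + 1))) ^ h) := by
  have hrefl : ∀ l : List I, ∃ p, l = l.eraseIdx p := fun l =>
    ⟨l.length, by rw [List.eraseIdx_of_length_le le_rfl]⟩
  induction h with
  | zero =>
    rintro j l l' hl F G hFG
    rw [noiseMean_zero, noiseMean_zero, pow_zero, one_mul]
    exact hFG _ _ ⟨0, by simpa [leaves] using hl, fun i hi => by simp [leaves, hi]⟩
  | succ h ih =>
    rintro j l _ ⟨p, rfl⟩ F G hFG
    rw [noiseMean_leaves_succ, noiseMean_leaves_succ]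
    set C := ENNReal.ofReal (q⁻¹ * (1 + 1 / ((R : ℝ) + 1))) with hC
    set κ := π (j + 2 ^ h) - π j
    set Ψ : ℤ → ENNReal := fun z => nodeMean (laplaceWeight q) π R h j G
      ((l.eraseIdx p).take (z + κ - R).toNat) ((l.eraseIdx p).drop (z + κ).toNat) with hΨ
    set lam : ℤ → ENNReal := fun z => ENNReal.ofReal (shiftProb R (p - (z + κ) + R))
    set mu : ℤ → ENNReal := fun z => ENNReal.ofReal (1 - shiftProb R (p - (z + κ) + R))
    have hsum : ∀ z, lam z + mu z = 1 := fun z => by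
      simp only [lam, mu]
      rw [← ENNReal.ofReal_add (shiftProb_nonneg _ _) (sub_nonneg.2 (shiftProb_le_one _ _))]
      simp
    have hstep : ∀ z, nodeMean (laplaceWeight q) π R h j F
        (l.take (z + κ - R).toNat) (l.drop (z + κ).toNat) ≤
        C ^ h * (lam z * Ψ (z - 1) + mu z * Ψ z) := by
      intro z
      have hS : (p : ℤ) < z + κ → nodeMean (laplaceWeight q) π R h j F
          (l.take (z + κ - R).toNat) (l.drop (z + κ).toNat) ≤ C ^ h * Ψ (z - 1) := by
        intro hp
        obtain ⟨h1, h2⟩ := eraseIdx_cut_shift l R hp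
        have e : z - 1 + κ = z + κ - 1 := by ring
        simp only [hΨ, e, h1]
        exact ih.nodeMean_left hrefl hFG j h2
      have hN : z + κ - R ≤ (p : ℤ) → nodeMean (laplaceWeight q) π R h j F
          (l.take (z + κ - R).toNat) (l.drop (z + κ).toNat) ≤ C ^ h * Ψ z := by
        intro hp
        obtain ⟨h1, h2⟩ := eraseIdx_cut_stay l hp
        simp only [hΨ, h1]
        exact ih.nodeMean_right hFG j h2
      rcases lt_or_ge (p : ℤ) (z + κ - R) with h1 | h1
      · have : shiftProb R (p - (z + κ) + R) = 1 := shiftProb_of_neg _ (by omega)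
        simpa [lam, mu, this] using hS (by omega)
      rcases le_or_gt (z + κ) (p : ℤ) with h2 | h2
      · have : shiftProb R (p - (z + κ) + R) = 0 := shiftProb_of_le (by omega)
        simpa [lam, mu, this] using hN h1
      · calc _ = (lam z + mu z) * nodeMean (laplaceWeight q) π R h j F
              (l.take (z + κ - R).toNat) (l.drop (z + κ).toNat) := by rw [hsum, one_mul]
          _ ≤ lam z * (C ^ h * Ψ (z - 1)) + mu z * (C ^ h * Ψ z) := by
              rw [add_mul]; gcongr
              · exact hS h2
              · exact hN h1
          _ = _ := by ring
    calc _ ≤ ∑' z, laplaceWeight q z * (C ^ h * (lam z * Ψ (z - 1) + mu z * Ψ z)) :=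
          ENNReal.tsum_le_tsum fun z => by gcongr; exact hstep z
      _ = C ^ h * (∑' z, laplaceWeight q z * lam z * Ψ (z - 1) +
            ∑' z, laplaceWeight q z * mu z * Ψ z) := by
          rw [← ENNReal.tsum_add, ← ENNReal.tsum_mul_left]
          exact tsum_congr fun z => by ring
      _ = C ^ h * (∑' z, laplaceWeight q (z + 1) * lam (z + 1) * Ψ z +
            ∑' z, laplaceWeight q z * mu z * Ψ z) := by
          congr 2
          rw [← (Equiv.addRight (1 : ℤ)).tsum_eq]
          simp
      _ = C ^ h * ∑' z, (laplaceWeight q (z + 1) * lam (z + 1) + laplaceWeight q z * mu z) * Ψ z := by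
          rw [← ENNReal.tsum_add]
          congr 1
          exact tsum_congr fun z => by ring
      _ ≤ C ^ h * ∑' z, C * laplaceWeight q z * Ψ z := by
          gcongr with z
          have hq1' : (1 : ℝ) ≤ q⁻¹ := (one_le_inv₀ hq).2 hq1.le
          have a1 : laplaceWeight q (z + 1) ≤ ENNReal.ofReal q⁻¹ * laplaceWeight q z :=
            laplaceWeight_le_mul hq hq1 (by omega)
          have a2 : laplaceWeight q z ≤ ENNReal.ofReal q⁻¹ * laplaceWeight q z :=
            laplaceWeight_le_mul hq hq1 (by omega)
          calc _ ≤ ENNReal.ofReal q⁻¹ * laplaceWeight q z * lam (z + 1) +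
                ENNReal.ofReal q⁻¹ * laplaceWeight q z * mu z := by gcongr
            _ = ENNReal.ofReal q⁻¹ * (lam (z + 1) + mu z) * laplaceWeight q z := by ring
            _ ≤ C * laplaceWeight q z := by
              gcongr
              rw [hC, ENNReal.ofReal_mul (by positivity)]
              gcongr
              simp only [lam, mu]
              rw [← ENNReal.ofReal_add (shiftProb_nonneg _ _) (sub_nonneg.2 (shiftProb_le_one _ _))]
              refine ENNReal.ofReal_le_ofReal ?_
              have e : (p : ℤ) - (z + 1 + κ) + R = p - (z + κ) + R - 1 := by ring
              rw [e]
              linarith [shiftProb_sub_one_le R (p - (z + κ) + R)]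
      _ = _ := by
          rw [pow_succ, mul_assoc, ← ENNReal.tsum_mul_left (a := C)]
          simp only [mul_assoc, hΨ]

/-- Cost of an insertion. The cuts behind the new entry are moved by one place, and this is an
injective map on the cuts. -/
theorem transports_insert {q : ℝ} (hq : 0 < q) (hq1 : q < 1) (π : ℕ → ℤ) (R h : ℕ) :
    Transports (laplaceWeight q) π R (fun l l' => ∃ p, l = l'.eraseIdx p) h
      (ENNReal.ofReal q⁻¹ ^ h) := by
  have hrefl : ∀ l : List I, ∃ p, l = l.eraseIdx p := fun l =>
    ⟨l.length, by rw [List.eraseIdx_of_length_le le_rfl]⟩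
  induction h with
  | zero =>
    rintro j l l' hl F G hFG
    rw [noiseMean_zero, noiseMean_zero, pow_zero, one_mul]
    exact hFG _ _ ⟨0, by simpa [leaves] using hl, fun i hi => by simp [leaves, hi]⟩
  | succ h ih =>
    rintro j _ l ⟨p, rfl⟩ F G hFG
    rw [noiseMean_leaves_succ, noiseMean_leaves_succ]
    set C := ENNReal.ofReal q⁻¹ with hC
    set κ := π (j + 2 ^ h) - π j
    set Ψ : ℤ → ENNReal := fun z => nodeMean (laplaceWeight q) π R h j G
      (l.take (z + κ - R).toNat) (l.drop (z + κ).toNat) with hΨ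
    set τ : ℤ → ℤ := fun z => if (p : ℤ) < z + κ then z + 1 else z with hτ
    have hinj : Function.Injective τ := by
      intro z z' hz
      simp only [hτ] at hz
      split_ifs at hz <;> omega
    have hstep : ∀ z, nodeMean (laplaceWeight q) π R h j F
        ((l.eraseIdx p).take (z + κ - R).toNat) ((l.eraseIdx p).drop (z + κ).toNat) ≤
        C ^ h * Ψ (τ z) := by
      intro z
      by_cases hp : (p : ℤ) < z + κ
      · obtain ⟨h1, h2⟩ := eraseIdx_cut_shift l (p := p) (c := z + κ + 1) R (by omega)
        have e : z + κ + 1 - 1 = z + κ := by ring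
        have e' : z + 1 + κ = z + κ + 1 := by ring
        rw [e] at h1 h2
        simp only [hτ, if_pos hp, hΨ, e', h1]
        exact ih.nodeMean_left hrefl hFG j h2
      · obtain ⟨h1, h2⟩ := eraseIdx_cut_stay l (p := p) (c := z + κ) (R := R) (by omega)
        simp only [hτ, if_neg hp, hΨ, h1]
        exact ih.nodeMean_right hFG j h2
    calc _ ≤ ∑' z, C * laplaceWeight q (τ z) * (C ^ h * Ψ (τ z)) :=
          ENNReal.tsum_le_tsum fun z => by
            gcongr
            · refine laplaceWeight_le_mul hq hq1 ?_
              simp only [hτ]; split_ifs <;> omega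
            · exact hstep z
      _ = C ^ (h + 1) * ∑' z, laplaceWeight q (τ z) * Ψ (τ z) := by
          rw [← ENNReal.tsum_mul_left]
          exact tsum_congr fun z => by ring
      _ ≤ C ^ (h + 1) * ∑' z, laplaceWeight q z * Ψ z := by
          refine mul_le_mul_right ?_ _
          exact ENNReal.tsum_comp_le_tsum_of_injective hinj fun z => laplaceWeight q z * Ψ z

/-! ### Deviation of the leaves from their nominal places -/

/-- The sum of the labels of the nodes at which the path to the leaf `i` turns right. This is the
difference between the actual and the nominal start of the leaf. -/
def deviation : (h : ℕ) → Noise h → ℕ → ℤ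
  | 0, _ => fun _ => 0
  | h + 1, (z, b) => fun i =>
    if i < 2 ^ h then deviation h b.1 i else z + deviation h b.2 (i - 2 ^ h)

theorem deviation_zero_right (h : ℕ) (b : Noise h) : deviation h b 0 = 0 := by
  induction h with
  | zero => rfl
  | succ h ih =>
    obtain ⟨z, b, b'⟩ := b
    simp [deviation, ih]

theorem noiseMean_exp_deviation_le {η s : ℝ} (hη : 0 < η) (hs : s = 1 ∨ s = -1) (h i : ℕ) :
    noiseMean (laplaceWeight (Real.exp (-η))) h
      (fun b => ENNReal.ofReal (Real.exp (s * (η / 2) * deviation h b i))) ≤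
      ENNReal.ofReal (4 / 3) ^ h := by
  have hw : ∑' z, laplaceWeight (Real.exp (-η)) z = 1 :=
    tsum_laplaceWeight (Real.exp_pos _) (by rw [Real.exp_lt_one_iff]; linarith)
  have h43 : 1 ≤ ENNReal.ofReal (4 / 3) := by
    rw [← ENNReal.ofReal_one]; exact ENNReal.ofReal_le_ofReal (by norm_num)
  induction h generalizing i with
  | zero => simp [noiseMean_zero, deviation]
  | succ h ih =>
    rw [noiseMean_succ, pow_succ']
    by_cases hi : i < 2 ^ h
    · simp only [deviation, if_pos hi, noiseMean_const hw, ENNReal.tsum_mul_right, hw, one_mul]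
      exact (ih i).trans (le_mul_of_one_le_left' h43)
    · simp only [deviation, if_neg hi, noiseMean_const hw]
      have : ∀ (z : ℤ) (b' : Noise h), ENNReal.ofReal (Real.exp (s * (η / 2) *
          ((z + deviation h b' (i - 2 ^ h) : ℤ) : ℝ))) =
          ENNReal.ofReal (Real.exp (s * (η / 2) * z)) *
            ENNReal.ofReal (Real.exp (s * (η / 2) * deviation h b' (i - 2 ^ h))) := by
        intro z b'
        rw [← ENNReal.ofReal_mul (Real.exp_pos _).le, ← Real.exp_add]
        congr 2
        push_cast
        ring
      simp only [this, noiseMean_mul_left, ← mul_assoc, ENNReal.tsum_mul_right]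
      gcongr
      · exact tsum_laplaceWeight_mul_exp_le hη hs
      · exact ih _

theorem noiseMean_sum (w : ℤ → ENNReal) (h : ℕ) {ι : Type*} (s : Finset ι)
    (F : ι → Noise h → ENNReal) :
    noiseMean w h (fun b => ∑ i ∈ s, F i b) = ∑ i ∈ s, noiseMean w h (F i) := by
  classical
  induction s using Finset.induction_on with
  | empty => simp [noiseMean]
  | insert i s hi ih => simp only [Finset.sum_insert hi, noiseMean_add, ih]

open Classical in
/-- Exponential Markov inequality and union bound for the deviations of all the leaves. -/
theorem noiseMean_deviation_tail {η t : ℝ} (hη : 0 < η) (h : ℕ) :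
    noiseMean (laplaceWeight (Real.exp (-η))) h
      (fun b => if ∀ i < 2 ^ h, |(deviation h b i : ℝ)| ≤ t then 0 else 1) ≤
      ENNReal.ofReal (2 * 2 ^ h * (4 / 3) ^ h * Real.exp (-(η / 2 * t))) := by
  set E : ℝ → ℕ → Noise h → ENNReal := fun s i b =>
    ENNReal.ofReal (Real.exp (s * (η / 2) * deviation h b i))
  set e := ENNReal.ofReal (Real.exp (-(η / 2 * t))) with he
  have hexp : ∀ (s : ℝ) (i : ℕ) (b : Noise h), t ≤ s * deviation h b i → 1 ≤ e * E s i b := by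
    intro s i b ht
    rw [he, ← ENNReal.ofReal_mul (Real.exp_pos _).le, ← Real.exp_add, ENNReal.one_le_ofReal,
      Real.one_le_exp_iff]
    nlinarith [mul_le_mul_of_nonneg_left ht hη.le]
  calc _ ≤ noiseMean (laplaceWeight (Real.exp (-η))) h
        (fun b => e * ∑ i ∈ Finset.range (2 ^ h), (E 1 i b + E (-1) i b)) := by
        refine noiseMean_mono fun b => ?_
        split_ifs with hb
        · exact zero_le
        · push Not at hb
          obtain ⟨i, hi, ht⟩ := hb
          have h1 : E 1 i b + E (-1) i b ≤ ∑ i ∈ Finset.range (2 ^ h), (E 1 i b + E (-1) i b) :=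
            Finset.single_le_sum (f := fun i => E 1 i b + E (-1) i b) (fun _ _ => zero_le)
              (Finset.mem_range.2 hi)
          refine le_trans ?_ (mul_le_mul_right h1 e)
          rw [mul_add]
          rcases lt_abs.1 ht with h2 | h2
          · exact (hexp 1 i b (by linarith)).trans le_self_add
          · exact (hexp (-1) i b (by linarith)).trans le_add_self
    _ ≤ e * ∑ i ∈ Finset.range (2 ^ h),
          (ENNReal.ofReal (4 / 3) ^ h + ENNReal.ofReal (4 / 3) ^ h) := by
        rw [noiseMean_mul_left, noiseMean_sum]
        gcongr with i _
        rw [noiseMean_add]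
        gcongr
        · exact noiseMean_exp_deviation_le hη (Or.inl rfl) h i
        · exact noiseMean_exp_deviation_le hη (Or.inr rfl) h i
    _ = _ := by
        rw [Finset.sum_const, Finset.card_range, nsmul_eq_mul, ← two_mul, he,
          ← ENNReal.ofReal_pow (by norm_num), ← ENNReal.ofReal_ofNat 2,
          ← ENNReal.ofReal_natCast, ← ENNReal.ofReal_mul (by norm_num),
          ← ENNReal.ofReal_mul (by positivity), ← ENNReal.ofReal_mul (Real.exp_pos _).le]
        congr 1
        push_cast
        ring

theorem add_le_of_forall_succ {S : ℕ → ℤ} {m : ℕ} {d : ℤ} (hd : 0 ≤ d)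
    (hS : ∀ i, i + 1 < m → S i + d ≤ S (i + 1)) {i i' : ℕ} (h : i < i') (h' : i' < m) :
    S i + d ≤ S i' := by
  induction i', h using Nat.le_induction with
  | base => exact hS i h'
  | succ i' h ih =>
    have := ih (by omega)
    have := hS i' h'
    omega

/-- If the leaves start at positions that are sufficiently far apart, then each of them has at least
`N` entries, which are contiguous in the original list. -/
theorem leaves_getElem? (π : ℕ → ℤ) (R N h j : ℕ) (l : List I) (b : Noise h)
    (hS : ∀ i, i + 1 < 2 ^ h → π (j + i) + deviation h b i + (N + R) ≤
      π (j + (i + 1)) + deviation h b (i + 1)) {i r : ℕ} (hi : i < 2 ^ h) (hr : r < N) :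
    (leaves π R h j l b i)[r]? = l[(π (j + i) - π j + deviation h b i + r).toNat]? := by
  induction h generalizing j l i with
  | zero =>
    have : i = 0 := by simpa using hi
    subst this
    simp [leaves, deviation]
  | succ h ih =>
    obtain ⟨z, b, b'⟩ := b
    have hpow : 2 ^ (h + 1) = 2 ^ h + 2 ^ h := by ring
    have hpos : 0 < 2 ^ h := by positivity
    have chain : ∀ {i i' : ℕ}, i < i' → i' < 2 ^ (h + 1) → _ := fun {i i'} =>
      add_le_of_forall_succ (S := fun i => π (j + i) + deviation (h + 1) (z, b, b') i)
        (by positivity) hS (i := i) (i' := i')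
    have hmid : deviation (h + 1) (z, b, b') (2 ^ h) = z := by
      simp [deviation, deviation_zero_right]
    have hzero : deviation (h + 1) (z, b, b') 0 = 0 := deviation_zero_right _ _
    have hnonneg : ∀ i < 2 ^ (h + 1), 0 ≤ π (j + i) - π j + deviation (h + 1) (z, b, b') i := by
      intro i hi
      rcases Nat.eq_zero_or_pos i with rfl | hi0
      · simp [hzero]
      · have := chain hi0 hi
        simp only [hzero, add_zero] at this
        omega
    rw [leaves_succ, appendAt]
    by_cases hih : i < 2 ^ h
    · rw [if_pos hih, ih j _ b ?_ hih, List.getElem?_take, if_pos ?_]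
      · simp only [deviation, if_pos hih]
      · have := chain hih (by omega)
        simp only [hmid] at this
        have h0 := hnonneg i hi
        simp only [deviation, if_pos hih] at this h0
        omega
      · intro i hi'
        have := hS i (by omega)
        simpa only [deviation, if_pos hi', if_pos (by omega : i < 2 ^ h)] using this
    · obtain ⟨i', rfl⟩ : ∃ i', i = 2 ^ h + i' := ⟨i - 2 ^ h, by omega⟩
      rw [if_neg hih, Nat.add_sub_cancel_left, ih (j + 2 ^ h) _ b' ?_ (by omega : i' < 2 ^ h),
        List.getElem?_drop]
      · have h0 : 0 ≤ π (j + (2 ^ h + i')) + deviation (h + 1) (z, b, b') (2 ^ h + i') -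
            (π (j + 2 ^ h) + z) := by
          rcases Nat.eq_zero_or_pos i' with rfl | hi0
          · simp [hmid]
          · have := chain (i := 2 ^ h) (i' := 2 ^ h + i') (by omega) hi
            simp only [hmid] at this
            omega
        have h1 := hnonneg (2 ^ h) (by omega)
        rw [hmid] at h1
        simp only [deviation, if_neg hih, Nat.add_sub_cancel_left] at h0 ⊢
        rw [add_assoc j]
        congr 1
        omega
      · intro i hi'
        have := hS (2 ^ h + i) (by omega)
        simp only [deviation, if_neg (by omega : ¬ 2 ^ h + i < 2 ^ h),
          if_neg (by omega : ¬ 2 ^ h + i + 1 < 2 ^ h), Nat.add_sub_cancel_left,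
          (by omega : 2 ^ h + i + 1 - 2 ^ h = i + 1)] at this
        rw [add_assoc j, add_assoc j, ← add_assoc (2 ^ h)]
        omega

/-! ### Estimating the rank of a query -/

theorem lt_countP_of_getElem?_le {l : List I} (hl : l.Pairwise (· ≤ ·)) {r : ℕ} {v y : I}
    (hr : l[r]? = some v) (hv : v ≤ y) : r < l.countP (· ≤ y) := by
  obtain ⟨hlt, rfl⟩ := List.getElem?_eq_some_iff.1 hr
  have h1 : (l.take (r + 1)).countP (· ≤ y) = (l.take (r + 1)).length := by
    rw [List.countP_eq_length]
    intro u hu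
    obtain ⟨i, hi, rfl⟩ := List.getElem_of_mem hu
    rw [List.getElem_take]
    simp only [List.length_take] at hi
    simpa using (hl.rel_get_of_le (a := ⟨i, by omega⟩) (b := ⟨r, hlt⟩) (by simp; omega)).trans hv
  have h2 := (List.take_sublist (r + 1) l).countP_le (p := (· ≤ y))
  rw [h1, List.length_take] at h2
  omega

theorem countP_le_of_lt_getElem? {l : List I} (hl : l.Pairwise (· ≤ ·)) {r : ℕ} {v y : I}
    (hr : l[r]? = some v) (hv : y < v) : l.countP (· ≤ y) ≤ r := by
  obtain ⟨hlt, rfl⟩ := List.getElem?_eq_some_iff.1 hr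
  have h1 : (l.drop r).countP (· ≤ y) = 0 := by
    rw [List.countP_eq_zero]
    intro u hu
    obtain ⟨i, hi, rfl⟩ := List.getElem_of_mem hu
    rw [List.getElem_drop]
    simp only [List.length_drop] at hi
    simpa using hv.trans_le
      (hl.rel_get_of_le (a := ⟨r, hlt⟩) (b := ⟨r + i, by omega⟩) (by simp))
  rw [← List.take_append_drop r l, List.countP_append, h1, add_zero]
  exact (List.countP_le_length).trans (by simp)

theorem statisticalQuery_threshold {n : ℕ} (y : I) (x : Fin n → I) {l : List I}
    (hl : l.Perm (List.ofFn x)) :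
    statisticalQuery (threshold y) x = (l.countP (· ≤ y) : ℝ) / n := by
  have h : ∀ l : List I, (l.map (threshold y)).sum = (l.countP (· ≤ y) : ℝ) := by
    intro l
    induction l with
    | nil => simp
    | cons a l ih =>
      rw [List.map_cons, List.sum_cons, ih, List.countP_cons, threshold]
      by_cases h : a ≤ y <;> simp [h, add_comm]
  unfold statisticalQuery
  rw [hl.countP_eq, ← h, List.map_ofFn, List.sum_ofFn]
  rfl

/-- The first `N` entries of `l`, padded by zeros. -/
def padded (N : ℕ) (l : List I) : Fin N → I := fun i => l.getD i 0

theorem exists_firstLeft {m : ℕ} (a : Fin m → Side) : ∃ j, ∀ h : j < m, a ⟨j, h⟩ = Side.L :=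
  ⟨m, fun h => absurd h (lt_irrefl m)⟩

open Classical in
/-- The first index with answer `L`, or `m` if there is none. -/
noncomputable def firstLeft {m : ℕ} (a : Fin m → Side) : ℕ := Nat.find (exists_firstLeft a)

theorem firstLeft_le {m : ℕ} (a : Fin m → Side) : firstLeft a ≤ m := by
  classical
  exact Nat.find_min' (exists_firstLeft a) fun h => absurd h (lt_irrefl m)

theorem apply_firstLeft {m : ℕ} {a : Fin m → Side} (h : firstLeft a < m) :
    a ⟨firstLeft a, h⟩ = Side.L := by
  classical
  exact Nat.find_spec (exists_firstLeft a) h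

theorem apply_of_lt_firstLeft {m : ℕ} {a : Fin m → Side} {j : ℕ} (h : j < firstLeft a) :
    a ⟨j, h.trans_le (firstLeft_le a)⟩ = Side.R := by
  classical
  by_contra hR
  refine Nat.find_min (exists_firstLeft a) h fun h' => ?_
  cases h2 : a ⟨j, h'⟩ with
  | L => rfl
  | R => exact absurd h2 hR

/-- The estimate of the fraction of the `n` entries below the query, from the answers of `m` copies
that hold `N` entries each. If `j` is the first copy with answer `L`, then the rank of the query is
between the starts of leaf `j - 1` and the last entry of copy `j`, up to the noise, and the estimate is
the middle of the nominal range. For `j = 0` the truncated subtraction gives the lower bound `0`, and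
for `j = m` the nominal start of leaf `m` is `n`. -/
noncomputable def estimate (n N m : ℕ) (a : Fin m → Side) : I :=
  Set.projIcc 0 1 zero_le_one
    ((((firstLeft a - 1) * n / m : ℕ) + (firstLeft a * n / m : ℕ) + (N : ℝ)) / (2 * n))

theorem abs_sub_projIcc_le {q v : ℝ} (h0 : 0 ≤ q) (h1 : q ≤ 1) :
    |q - Set.projIcc (0 : ℝ) 1 zero_le_one v| ≤ |q - v| := by
  rw [Set.coe_projIcc]
  rcases le_total v 0 with hv | hv
  · rw [max_eq_left ((min_le_right _ _).trans hv), abs_of_nonneg (by linarith), abs_of_nonneg (by linarith)]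
    linarith
  rcases le_total v 1 with hv' | hv'
  · rw [min_eq_right hv', max_eq_right hv]
  · rw [min_eq_left hv', max_eq_right zero_le_one, abs_of_nonpos (by linarith),
      abs_of_nonpos (by linarith)]
    linarith

theorem natCast_div_le_lt {m : ℕ} (hm : 0 < m) (n j : ℕ) :
    ((j * n / m : ℕ) : ℝ) ≤ j * (n / m) ∧ j * ((n : ℝ) / m) < ((j * n / m : ℕ) : ℝ) + 1 := by
  have hm' : (0 : ℝ) < m := by exact_mod_cast hm
  constructor
  · refine (Nat.cast_div_le).trans (le_of_eq ?_)
    push_cast; ring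
  · have := Nat.lt_div_mul_add (a := j * n) hm
    have h2 : ((j * n : ℕ) : ℝ) < ((j * n / m * m + m : ℕ) : ℝ) := by exact_mod_cast this
    push_cast at h2
    rw [← mul_div_assoc, div_lt_iff₀ hm']
    linarith

/-- Accuracy of the estimate if all deviations are at most `t` and all the copies solve the interior
point problem. -/
theorem thresholdLoss_estimate_le {n N R h m : ℕ} {α t : ℝ} (hn : 0 < n) (hmh : 2 ^ h = m) (x : Fin n → I) (y : I)
    {l : List I} (hl : l.Pairwise (· ≤ ·)) (hlx : l.Perm (List.ofFn x)) (b : Noise h)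
    (hb : ∀ i < m, |(deviation h b i : ℝ)| ≤ t)
    (hα : (n : ℝ) / m + 1 + N + 2 * t ≤ 2 * α * n)
    (hN : (N : ℝ) + R + 2 * t + 1 ≤ n / m) (a : Fin m → Side)
    (ha : ∀ i : Fin m,
      ((∀ r, y < padded N (leaves (fun j => (j * n / m : ℕ)) R h 0 l b i) r) → a i = Side.L) ∧
      ((∀ r, padded N (leaves (fun j => (j * n / m : ℕ)) R h 0 l b i) r ≤ y) →
        a i = Side.R)) :
    thresholdLoss y x (estimate n N m a) ≤ α := by
  have hn' : (0 : ℝ) < n := by exact_mod_cast hn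
  have hm : 0 < m := hmh ▸ (by positivity)
  have hm' : (0 : ℝ) < m := by exact_mod_cast hm
  have ht : 0 ≤ t := (abs_nonneg _).trans (hb 0 hm)
  set P : ℕ → ℕ := fun j => j * n / m with hP
  have hP1 : ∀ j, (P j : ℝ) ≤ j * (n / m) := fun j => (natCast_div_le_lt hm n j).1
  have hP2 : ∀ j : ℕ, j * ((n : ℝ) / m) < P j + 1 := fun j => (natCast_div_le_lt hm n j).2
  have hP0 : P 0 = 0 := by simp [hP]
  have hPm : P m = n := by simp [hP, hm]
  have hspace : ∀ i, i + 1 < m → (P (0 + i) : ℤ) + deviation h b i + (N + R) ≤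
      (P (0 + (i + 1)) : ℤ) + deviation h b (i + 1) := by
    intro i hi
    have h1 := abs_le.1 (hb i (by omega))
    have h2 := abs_le.1 (hb (i + 1) hi)
    have h3 := hP1 i
    have h4 := hP2 (i + 1)
    push_cast at h4
    rw [zero_add, zero_add]
    have : (P i : ℝ) + deviation h b i + (N + R) ≤ P (i + 1) + deviation h b (i + 1) := by
      linarith
    exact_mod_cast this
  set S : ℕ → ℤ := fun i => (P i : ℤ) + deviation h b i with hS
  have hS0 : ∀ i < m, 0 ≤ S i := by
    intro i hi
    rcases Nat.eq_zero_or_pos i with rfl | hi0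
    · simp [hS, hP0, deviation_zero_right]
    · have := add_le_of_forall_succ (S := S) (m := m) (d := N + R) (by positivity)
        (by simpa only [zero_add] using hspace) hi0 hi
      have h0 : S 0 = 0 := by simp [hS, hP0, deviation_zero_right]
      omega
  have hlen : l.length = n := by rw [hlx.length_eq, List.length_ofFn]
  have hSn : ∀ i < m, S i + N ≤ n := by
    intro i hi
    have h1 := abs_le.1 (hb i hi)
    have h2 := hP1 i
    have h3 : (i : ℝ) + 1 ≤ m := by exact_mod_cast hi
    have h4 : ((i : ℝ) + 1) * (n / m) ≤ m * (n / m) := by gcongr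
    have h5 : (m : ℝ) * (n / m) = n := by field_simp
    have h6 : (0 : ℝ) ≤ R := by positivity
    have : ((S i : ℤ) : ℝ) + N ≤ n := by
      simp only [hS]; push_cast; linarith
    exact_mod_cast this
  have hget : ∀ i < m, ∀ r (hr : r < N), l[(S i + r).toNat]? =
      some (padded N (leaves (fun j => (P j : ℤ)) R h 0 l b i) ⟨r, hr⟩) := by
    intro i hi r hr
    have h1 := leaves_getElem? (fun j => (P j : ℤ)) R N h 0 l b (hmh.symm ▸ hspace)
      (hmh.symm ▸ hi) hr
    have h2 : (S i + r).toNat < l.length := by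
      have := hSn i hi; have := hS0 i hi; omega
    simp only [zero_add, hP0, Nat.cast_zero, sub_zero] at h1
    simp only [padded, List.getD, h1]
    rw [List.getElem?_eq_getElem (by exact h2)]
    rfl
  set c := l.countP (· ≤ y) with hc
  have hL : ∀ i : Fin m, a i = Side.L → (c : ℤ) ≤ S i + N := by
    intro i hi
    have : ∃ r, y < padded N (leaves (fun j => (P j : ℤ)) R h 0 l b i) r := by
      by_contra! hcon
      have := (ha i).2 hcon
      rw [hi] at this
      cases this
    obtain ⟨r, hr⟩ := this
    have := countP_le_of_lt_getElem? hl (hget i i.2 r r.2) hr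
    have := hS0 i i.2
    have := r.2
    omega
  have hR : ∀ i : Fin m, a i = Side.R → S i ≤ (c : ℤ) := by
    intro i hi
    have : ∃ r, padded N (leaves (fun j => (P j : ℤ)) R h 0 l b i) r ≤ y := by
      by_contra! hcon
      have := (ha i).1 hcon
      rw [hi] at this
      cases this
    obtain ⟨r, hr⟩ := this
    have := lt_countP_of_getElem?_le hl (hget i i.2 r r.2) hr
    omega
  set J := firstLeft a with hJ
  have hlow : (P (J - 1) : ℝ) - t ≤ c := by
    rcases Nat.eq_zero_or_pos J with h0 | h0
    · rw [h0]
      have : (0 : ℝ) ≤ c := by positivity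
      simp [hP0]; linarith
    · have hlt : J - 1 < firstLeft a := by omega
      have h1 := hR ⟨J - 1, _⟩ (apply_of_lt_firstLeft hlt)
      have h2 := abs_le.1 (hb (J - 1) (hlt.trans_le (firstLeft_le a)))
      have h3 : ((S (J - 1) : ℤ) : ℝ) ≤ c := by exact_mod_cast h1
      simp only [hS] at h3
      push_cast at h3
      linarith
  have hcn : c ≤ n := hlen ▸ List.countP_le_length
  have hcn' : (c : ℝ) ≤ n := by exact_mod_cast hcn
  have hhigh : (c : ℝ) ≤ P J + t + N := by
    rcases (firstLeft_le a).eq_or_lt with h0 | h0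
    · rw [hJ, h0, hPm]
      have : (0 : ℝ) ≤ N := by positivity
      linarith
    · have h1 := hL ⟨J, h0⟩ (apply_firstLeft h0)
      have h2 := abs_le.1 (hb J h0)
      have h3 : (c : ℝ) ≤ ((S J : ℤ) : ℝ) + N := by exact_mod_cast h1
      simp only [hS] at h3
      push_cast at h3
      linarith
  have hdiff : (P J : ℝ) ≤ P (J - 1) + n / m + 1 := by
    rcases Nat.eq_zero_or_pos J with h0 | h0
    · rw [h0]; simp only [hP0]; simp; positivity
    · have h1 := hP1 J
      have h2 := hP2 (J - 1)
      rw [Nat.cast_sub h0] at h2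
      push_cast at h2
      linarith
  unfold thresholdLoss
  rw [statisticalQuery_threshold y x hlx]
  refine (abs_sub_projIcc_le (by positivity) ((div_le_one hn').2 hcn')).trans ?_
  change |(c : ℝ) / n - ((P (J - 1) : ℝ) + P J + N) / (2 * n)| ≤ α
  have e : (c : ℝ) / n - ((P (J - 1) : ℝ) + P J + N) / (2 * n) =
      (2 * c - (P (J - 1) + P J + N)) / (2 * n) := by field_simp
  rw [e, abs_div, abs_of_pos (by positivity : (0 : ℝ) < 2 * n), div_le_iff₀ (by positivity), abs_le]
  constructor <;> linarith

/-! ### Choice of the parameters -/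

theorem mul_sq_le_rpow_five_halves {Λ s : ℝ} (h : s ^ 2 ≤ Λ) :
    s * Λ ^ 2 ≤ Λ ^ (5 / 2 : ℝ) := by
  have hΛ : 0 ≤ Λ := (sq_nonneg s).trans h
  have h1 : s ≤ Real.sqrt Λ := Real.le_sqrt_of_sq_le h
  have h2 : Λ ^ (5 / 2 : ℝ) = Real.sqrt Λ * Λ ^ 2 := by
    rw [Real.sqrt_eq_rpow, ← Real.rpow_natCast, ← Real.rpow_add_of_nonneg hΛ (by norm_num)
      (by norm_num)]
    norm_num
  rw [h2]
  gcongr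

/-- The inequality behind the constant `24`: the left side bounds the noise of a tree of height `L`, and
`0.693` is a lower bound for `log 2`. -/
theorem sq_add_le_rpow {L : ℕ} {Λ : ℝ} (hL : 1 ≤ L) (hΛ : 0.693 * (L + 1.4) ≤ Λ) :
    (L : ℝ) ^ 2 + 1.75 * L ≤ Λ ^ (5 / 2 : ℝ) := by
  have key : ∀ s : ℝ, 0 ≤ s → s ^ 2 ≤ 0.693 * (L + 1.4) →
      (L : ℝ) ^ 2 + 1.75 * L ≤ s * (0.693 * (L + 1.4)) ^ 2 →
      (L : ℝ) ^ 2 + 1.75 * L ≤ Λ ^ (5 / 2 : ℝ) := by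
    intro s hs h1 h2
    refine h2.trans (le_trans ?_ (mul_sq_le_rpow_five_halves (h1.trans hΛ)))
    gcongr
  -- `s` is a numerical lower bound for the square root of `0.693 * (L + 1.4)`.
  rcases Nat.lt_or_ge L 6 with h | h
  · interval_cases L
    · exact key 1.28 (by norm_num) (by norm_num) (by norm_num)
    · exact key 1.53 (by norm_num) (by norm_num) (by norm_num)
    · exact key 1.74 (by norm_num) (by norm_num) (by norm_num)
    · exact key 1.93 (by norm_num) (by norm_num) (by norm_num)
    · exact key 2.1 (by norm_num) (by norm_num) (by norm_num)
  · have h6 : (6 : ℝ) ≤ L := by exact_mod_cast h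
    exact key 2.25 (by norm_num) (by nlinarith) (by nlinarith)

/-- Parameters of the partition: the height `L` and the gap `R` of the tree, the rate `η` of the noise
and a bound `t` for the deviations that holds with probability at least `1 - β / 2`. -/
theorem exists_parameters {α β ε : ℝ} (hα : 0 < α) (hα1 : α < 1 / 2) (hβ : 0 < β) (hβ1 : β < 1)
    (hε : 0 < ε) {n N : ℕ} (hN : 1 ≤ N)
    (hn : max (6 * N / α) (24 * Real.log (4 / α) ^ (5 / 2 : ℝ) * Real.log (2 / β) / (α * ε)) ≤
      (n : ℝ)) :
    ∃ (L R : ℕ) (η t : ℝ), 0 < η ∧ 2 ^ L * (α * β / 8) ≤ β / 2 ∧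
      2 * 2 ^ L * (4 / 3) ^ L * Real.exp (-(η / 2 * t)) ≤ β / 2 ∧
      (n : ℝ) / 2 ^ L + 1 + N + 2 * t ≤ 2 * α * n ∧ (N : ℝ) + R + 2 * t + 1 ≤ n / 2 ^ L ∧
      (Real.exp η * (1 + 1 / (R + 1))) ^ L * Real.exp η ^ L ≤ Real.exp (2 * ε) := by
  obtain ⟨p, hp1, hp2⟩ := exists_nat_pow_near (x := 3 / (4 * α)) (y := 2)
    (by rw [le_div_iff₀ (by positivity)]; linarith) one_lt_two
  -- `2 ^ L` is between `3 / (4 α)` and `3 / (2 α)`: the nominal length of a leaf is between `2 α n / 3`,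
  -- which leaves room for `n'` entries, the gap and the noise, and `4 α n / 3`, which keeps the
  -- uncertainty of the estimate below `2 α n`.
  set L := p + 1 with hL
  have hL0 : 1 ≤ L := by omega
  have hL0' : (1 : ℝ) ≤ L := by exact_mod_cast hL0
  have hL1 : (2 : ℝ) ^ L * α ≤ 3 / 2 := by
    rw [le_div_iff₀ (by positivity)] at hp1
    rw [hL, pow_succ]; linarith
  have hL2 : 3 / 4 ≤ (2 : ℝ) ^ L * α := by
    rw [div_lt_iff₀ (by positivity)] at hp2
    linarith
  have h2L : (0 : ℝ) < 2 ^ L := by positivity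
  have hl2 := Real.log_two_gt_d9
  set b := Real.log (2 / β) with hb
  have hb2 : Real.log 2 ≤ b := Real.log_le_log two_pos (by rw [le_div_iff₀ hβ]; linarith)
  have hb0 : 0 < b := by linarith
  -- Of the budget `2 ε`, the noise takes `2 L η = 3 ε / 2` and the collisions take `ε / 2`.
  set η := 3 * ε / (4 * L) with hη
  have hη0 : 0 < η := by positivity
  set R := ⌊2 * L / ε⌋₊ with hR
  have hR1 : (R : ℝ) ≤ 2 * L / ε := Nat.floor_le (by positivity)
  have hR2 : 2 * L / ε < (R : ℝ) + 1 := Nat.lt_floor_add_one _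
  set t := 2 / η * (Real.log (4 / β) + L * Real.log (8 / 3)) with ht
  have h83 : Real.log (8 / 3) ≤ 3 / 2 * Real.log 2 := by
    have : 2 * Real.log (8 / 3) ≤ 3 * Real.log 2 := by
      rw [← Real.log_rpow (by norm_num), ← Real.log_rpow (by norm_num)]
      exact Real.log_le_log (by positivity) (by norm_num)
    linarith
  have h83' : 7 / 5 * Real.log 2 ≤ Real.log (8 / 3) := by
    have : 7 * Real.log 2 ≤ 5 * Real.log (8 / 3) := by
      rw [← Real.log_rpow (by norm_num), ← Real.log_rpow (by norm_num)]
      exact Real.log_le_log (by positivity) (by norm_num)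
    linarith
  have hΛ : 0.693 * ((L : ℝ) + 1.4) ≤ Real.log (4 / α) := by
    have h1 : Real.log (2 ^ L * (8 / 3)) ≤ Real.log (4 / α) :=
      Real.log_le_log (by positivity) (by rw [le_div_iff₀ hα]; linarith)
    rw [Real.log_mul (by positivity) (by norm_num), Real.log_pow] at h1
    nlinarith
  have hkey := sq_add_le_rpow hL0 hΛ
  set E := Real.log (4 / α) ^ (5 / 2 : ℝ) with hE
  have hn1 : 6 * N ≤ α * n := by
    have := (le_max_left _ _).trans hn
    rw [div_le_iff₀ hα] at this
    linarith
  have hn2 : 24 * (E * b / ε) ≤ α * n := by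
    have := (le_max_right _ _).trans hn
    rw [div_le_iff₀ (by positivity)] at this
    rw [← mul_div_assoc, div_le_iff₀ hε]
    linarith
  have hN' : (1 : ℝ) ≤ N := by exact_mod_cast hN
  have h4β : Real.log (4 / β) = Real.log 2 + b := by
    rw [hb, ← Real.log_mul (by norm_num) (by positivity)]
    congr 1; ring
  have hmain : 2 * t + R ≤ 8 * (E * b / ε) := by
    have h1 : 2 * t ≤ b / ε * (L * (32 / 3 + 8 * L)) := by
      have e : 2 * t = 16 * L / (3 * ε) * (Real.log (4 / β) + L * Real.log (8 / 3)) := by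
        rw [ht, hη]; field_simp; ring
      have e2 : b / ε * (L * (32 / 3 + 8 * L)) = 16 * L / (3 * ε) * (2 * b + L * (3 / 2 * b)) := by
        field_simp; ring
      rw [e, e2, h4β]
      gcongr ?_ * (?_ + ?_ * ?_)
      · linarith
      · linarith
    have h2 : (R : ℝ) ≤ b / ε * (3 * L) := by
      refine hR1.trans ?_
      rw [div_mul_eq_mul_div, div_le_div_iff_of_pos_right hε]
      nlinarith
    have h3 : 8 * (E * b / ε) = b / ε * (8 * E) := by ring
    rw [h3]
    calc 2 * t + R ≤ b / ε * (L * (32 / 3 + 8 * L) + 3 * L) := by rw [mul_add]; linarith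
      _ ≤ _ := by gcongr; nlinarith
  have hnL1 : 2 / 3 * (α * n) ≤ n / 2 ^ L := by
    rw [le_div_iff₀ h2L]
    have := mul_le_mul_of_nonneg_left hL1 (Nat.cast_nonneg (α := ℝ) n)
    linarith
  have hnL2 : n / 2 ^ L ≤ 4 / 3 * (α * n) := by
    rw [div_le_iff₀ h2L]
    have := mul_le_mul_of_nonneg_left hL2 (Nat.cast_nonneg (α := ℝ) n)
    linarith
  have hR0 : (0 : ℝ) ≤ R := by positivity
  refine ⟨L, R, η, t, hη0, ?_, ?_, ?_, ?_, ?_⟩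
  · have := mul_le_mul_of_nonneg_right hL1 hβ.le
    linarith
  · have e : η / 2 * t = Real.log (4 / β) + Real.log ((8 / 3) ^ L) := by
      rw [ht, Real.log_pow]; field_simp
    rw [e, ← Real.log_mul (by positivity) (by positivity), Real.exp_neg,
      Real.exp_log (by positivity)]
    refine le_of_eq ?_
    have : (2 : ℝ) ^ L * (4 / 3) ^ L = (8 / 3) ^ L := by rw [← mul_pow]; norm_num
    rw [mul_assoc 2, this]
    field_simp
    ring
  · linarith
  · linarith
  · have h1 : 1 + 1 / ((R : ℝ) + 1) ≤ Real.exp (ε / (2 * L)) := by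
      have h2 : 1 / ((R : ℝ) + 1) ≤ ε / (2 * L) := by
        rw [div_le_div_iff₀ (by positivity) (by positivity)]
        rw [div_lt_iff₀ hε] at hR2
        linarith
      have := Real.add_one_le_exp (ε / (2 * L))
      linarith
    calc _ ≤ (Real.exp η * Real.exp (ε / (2 * L))) ^ L * Real.exp η ^ L := by gcongr
      _ = Real.exp (2 * ε) := by
        rw [← Real.exp_add, ← Real.exp_nat_mul, ← Real.exp_nat_mul, ← Real.exp_add]
        congr 1
        rw [hη]; field_simp; ring

/-! ### Adjacent datasets as sorted lists -/

theorem Adjacent.symm {X : Type*} {n : ℕ} {x x' : Fin n → X} (h : Adjacent x x') :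
    Adjacent x' x := by
  obtain ⟨i, hi⟩ := h
  exact ⟨i, fun j hj => (hi j hj).symm⟩

theorem Adjacent.comp_perm {X : Type*} {n : ℕ} {x x' : Fin n → X} (h : Adjacent x x')
    (ρ : Equiv.Perm (Fin n)) : Adjacent (x ∘ ρ) (x' ∘ ρ) := by
  obtain ⟨i, hi⟩ := h
  refine ⟨ρ.symm i, fun j hj => hi _ fun h => hj ?_⟩
  rw [← h, Equiv.symm_apply_apply]

/-- Erasing an entry of a list changes its first `N` entries, as a multiset, by one substitution. -/
theorem exists_adjacent_padded_eraseIdx {N : ℕ} (hN : 1 ≤ N) (l : List I) (p : ℕ) :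
    ∃ τ : Equiv.Perm (Fin N), Adjacent (padded N l) (padded N (l.eraseIdx p) ∘ τ) := by
  obtain ⟨N, rfl⟩ : ∃ N', N = N' + 1 := ⟨N - 1, by omega⟩
  by_cases hp : p < N + 1
  · refine ⟨(finSuccEquiv' ⟨p, hp⟩).trans (finSuccEquiv' (Fin.last N)).symm, ⟨p, hp⟩, ?_⟩
    intro j hj
    obtain ⟨i, rfl⟩ := Fin.exists_succAbove_eq hj
    simp only [Function.comp_apply, Equiv.trans_apply, finSuccEquiv'_succAbove,
      finSuccEquiv'_symm_some, Fin.succAbove_last, padded, List.getD, List.getElem?_eraseIdx,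
      Fin.val_castSucc]
    by_cases h : (i : ℕ) < p
    · rw [if_pos h, Fin.succAbove_of_castSucc_lt _ _ (by simpa [Fin.lt_def] using h)]
      rfl
    · rw [if_neg h, Fin.succAbove_of_le_castSucc _ _ (by simpa [Fin.le_def] using h)]
      rfl
  · refine ⟨1, 0, fun j _ => ?_⟩
    have : (j : ℕ) < p := by have := j.2; omega
    simp [padded, List.getD, List.getElem?_eraseIdx, this]

/-- The sorted list of the entries of a dataset. -/
noncomputable def sortedList {n : ℕ} (x : Fin n → I) : List I :=
  (List.ofFn x).insertionSort (· ≤ ·)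

theorem sortedList_perm {n : ℕ} (x : Fin n → I) : (sortedList x).Perm (List.ofFn x) :=
  List.perm_insertionSort _ _

theorem sortedList_pairwise {n : ℕ} (x : Fin n → I) : (sortedList x).Pairwise (· ≤ ·) :=
  List.pairwise_insertionSort _ _

/-- The sorted lists of adjacent datasets become equal when one entry is erased from each. -/
theorem Adjacent.exists_eraseIdx_eq {n : ℕ} {x x' : Fin n → I} (h : Adjacent x x') :
    ∃ p q, (sortedList x).eraseIdx p = (sortedList x').eraseIdx q := by
  obtain ⟨i, hi⟩ := h
  have key : ∀ x : Fin n → I, ∃ p,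
      ((sortedList x).eraseIdx p : Multiset I) = (Finset.univ.erase i).val.map x := by
    intro x
    obtain ⟨p, hp, hpx⟩ := List.getElem_of_mem
      ((sortedList_perm x).mem_iff.2 ((List.mem_ofFn' _ _).2 ⟨i, rfl⟩))
    refine ⟨p, (Multiset.cons_inj_right (x i)).1 ?_⟩
    rw [Multiset.cons_coe, ← hpx,
      Multiset.coe_eq_coe.2 (List.getElem_cons_eraseIdx_perm hp), hpx, ← Multiset.map_cons,
      Finset.erase_val, Multiset.cons_erase (Finset.mem_univ_val i), Fin.univ_val_map]
    exact Multiset.coe_eq_coe.2 (sortedList_perm x)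
  obtain ⟨p, hp⟩ := key x
  obtain ⟨q, hq⟩ := key x'
  refine ⟨p, q, ?_⟩
  have hperm : ((sortedList x).eraseIdx p).Perm ((sortedList x').eraseIdx q) := by
    rw [← Multiset.coe_eq_coe, hp, hq]
    refine Multiset.map_congr rfl fun j hj => hi j ?_
    exact Finset.ne_of_mem_erase (show j ∈ Finset.univ.erase i from hj)
  exact hperm.eq_of_pairwise (fun a b _ _ => le_antisymm)
    ((sortedList_pairwise x).sublist (List.eraseIdx_sublist _ _))
    ((sortedList_pairwise x').sublist (List.eraseIdx_sublist _ _))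

/-! ### Algorithms on reordered datasets -/

instance (n : ℕ) : MeasurableSpace (Equiv.Perm (Fin n)) := ⊤

instance (n : ℕ) : DiscreteMeasurableSpace (Equiv.Perm (Fin n)) := ⟨fun _ => trivial⟩

namespace InteractiveAlgorithm

variable {X Q R : Type} [MeasurableSpace Q] [MeasurableSpace R] {n : ℕ}

/-- `T` on a uniformly random reordering of the dataset. -/
noncomputable abbrev symmetrize (T : InteractiveAlgorithm X Q R n) : InteractiveAlgorithm X Q R n :=
  T.preprocess (PMF.uniformOfFintype (Equiv.Perm (Fin n))) fun x ρ => x ∘ ρ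

theorem interaction_symmetrize_comp_perm (T : InteractiveAlgorithm X Q R n) (A : Adversary Q R)
    (k : ℕ) (x : Fin n → X) (τ : Equiv.Perm (Fin n)) {S : Set ((Fin k → Q) × (Fin k → R))}
    (hS : MeasurableSet S) :
    T.symmetrize.interaction A k (x ∘ τ) S = T.symmetrize.interaction A k x S := by
  rw [interaction_preprocess_apply _ _ _ _ _ _ hS, interaction_preprocess_apply _ _ _ _ _ _ hS]
  conv_rhs => rw [← (Equiv.mulLeft τ).tsum_eq]
  refine tsum_congr fun ρ => ?_
  simp only [PMF.uniformOfFintype_apply]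
  rfl

/-- `symmetrize` is private for datasets that are adjacent as multisets. -/
theorem IsPrivate.symmetrize_le {T : InteractiveAlgorithm X Q R n} {k : ℕ} {ε δ : ℝ}
    (hT : T.IsPrivate k ε δ) (hδ : 0 ≤ δ) {x x' : Fin n → X} {τ : Equiv.Perm (Fin n)}
    (h : Adjacent x (x' ∘ τ)) (A : Adversary Q R) {S : Set ((Fin k → Q) × (Fin k → R))}
    (hS : MeasurableSet S) :
    T.symmetrize.interaction A k x S ≤
      ENNReal.ofReal (Real.exp ε) * T.symmetrize.interaction A k x' S + ENNReal.ofReal δ := by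
  rw [← interaction_symmetrize_comp_perm T A k x' τ hS,
    interaction_preprocess_apply _ _ _ _ _ _ hS, interaction_preprocess_apply _ _ _ _ _ _ hS]
  set p := PMF.uniformOfFintype (Equiv.Perm (Fin n))
  calc _ ≤ ∑' ρ, p ρ * (ENNReal.ofReal (Real.exp ε) * T.interaction A k ((x' ∘ τ) ∘ ρ) S +
          ENNReal.ofReal δ) := by
        refine ENNReal.tsum_le_tsum fun ρ => mul_le_mul_right ?_ _
        exact measure_le_of_measureReal_le (Real.exp_pos _).le hδ (hT A _ _ (h.comp_perm ρ) S hS)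
    _ = _ := by
        simp only [mul_add, ENNReal.tsum_add, ENNReal.tsum_mul_right, p.tsum_coe, one_mul]
        congr 1
        rw [← ENNReal.tsum_mul_left]
        exact tsum_congr fun ρ => by ring

end InteractiveAlgorithm

instance : DiscreteMeasurableSpace Side := ⟨fun _ => trivial⟩

instance : Finite Side :=
  Finite.of_injective (fun s : Side => match s with | .L => true | .R => false) fun s s' h => by
    cases s <;> cases s' <;> simp_all

/-- The transcripts that solve the online interior point problem for the dataset `x`. -/
def oipSuccess (k : ℕ) {n : ℕ} (x : Fin n → I) : Set ((Fin k → I) × (Fin k → Side)) :=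
  {t | ∀ j, ((∀ i, t.1 j < x i) → t.2 j = Side.L) ∧ ((∀ i, x i ≤ t.1 j) → t.2 j = Side.R)}

theorem measurableSet_oipSuccess (k : ℕ) {n : ℕ} (x : Fin n → I) :
    MeasurableSet (oipSuccess k x) := by
  have e : oipSuccess k x = ⋂ j, (((⋂ i, {t | t.1 j < x i})ᶜ ∪ {t | t.2 j = Side.L}) ∩
      ((⋂ i, {t | x i ≤ t.1 j})ᶜ ∪ {t | t.2 j = Side.R})) := by
    ext t
    simp only [oipSuccess, Set.mem_iInter, Set.mem_inter_iff, Set.mem_union, Set.mem_compl_iff,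
      Set.mem_ofPred_eq, imp_iff_not_or]
  rw [e]
  refine MeasurableSet.iInter fun j => ?_
  have hq : Measurable fun t : (Fin k → I) × (Fin k → Side) => t.1 j :=
    (measurable_pi_apply j).comp measurable_fst
  have ha : Measurable fun t : (Fin k → I) × (Fin k → Side) => t.2 j :=
    (measurable_pi_apply j).comp measurable_snd
  exact ((MeasurableSet.iInter fun i => measurableSet_lt hq measurable_const).compl.union
    (ha (measurableSet_singleton Side.L))).inter
    ((MeasurableSet.iInter fun i => measurableSet_le measurable_const hq).compl.union
    (ha (measurableSet_singleton Side.R)))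

theorem SolvesOIP.symmetrize_le {n : ℕ} {T : InteractiveAlgorithm I I Side n} {k : ℕ} {β : ℝ}
    (hT : SolvesOIP T k β) (hβ : 0 ≤ β) (A : Adversary I Side) (x : Fin n → I) :
    T.symmetrize.interaction A k x (oipSuccess k x)ᶜ ≤ ENNReal.ofReal β := by
  rw [InteractiveAlgorithm.interaction_preprocess_apply _ _ _ _ _ _
    (measurableSet_oipSuccess k x).compl]
  calc _ ≤ ∑' ρ, PMF.uniformOfFintype (Equiv.Perm (Fin n)) ρ * ENNReal.ofReal β := by
        refine ENNReal.tsum_le_tsum fun ρ => mul_le_mul_right ?_ _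
        have e : oipSuccess k x = oipSuccess k (x ∘ ρ) := by
          ext t
          have h1 : ∀ y, (∀ i, y < x i) ↔ ∀ i, y < x (ρ i) := fun y =>
            (ρ.forall_congr_right (q := fun i => y < x i)).symm
          have h2 : ∀ y, (∀ i, x i ≤ y) ↔ ∀ i, x (ρ i) ≤ y := fun y =>
            (ρ.forall_congr_right (q := fun i => x i ≤ y)).symm
          simp only [oipSuccess, Set.mem_ofPred_eq, Function.comp_apply, h1, h2]
        rw [e]
        exact (one_sub_le_measureReal_iff (measurableSet_oipSuccess k _) hβ).1 (hT A (x ∘ ρ))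
    _ = _ := by rw [ENNReal.tsum_mul_right, PMF.tsum_coe, one_mul]

/-- For the empty dataset, every query would require both answers. -/
theorem SolvesOIP.one_le_of_pos {n k : ℕ} {T : InteractiveAlgorithm I I Side n} {β : ℝ}
    (hT : SolvesOIP T k β) (hβ : β < 1) (hk : 0 < k) : 1 ≤ n := by
  rcases Nat.eq_zero_or_pos n with rfl | h
  · let A : Adversary I Side :=
      { Coins := Unit, law := Measure.dirac (), query := fun _ _ _ => 0
        measurable_query := fun _ => measurable_const }
    have := hT A Fin.elim0
    have e : {t : (Fin k → I) × (Fin k → Side) | ∀ j,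
        ((∀ i : Fin 0, t.1 j < Fin.elim0 i) → t.2 j = Side.L) ∧
        ((∀ i : Fin 0, Fin.elim0 i ≤ t.1 j) → t.2 j = Side.R)} = ∅ := by
      refine Set.eq_empty_of_forall_notMem fun t ht => ?_
      obtain ⟨h1, h2⟩ := ht ⟨0, hk⟩
      have := (h1 fun i => i.elim0).symm.trans (h2 fun i => i.elim0)
      cases this
    rw [e] at this
    simp at this
    linarith
  · exact h

theorem measurable_thresholdLoss {n : ℕ} (x : Fin n → I) :
    Measurable fun p : I × I => thresholdLoss p.1 x p.2 := by
  unfold thresholdLoss statisticalQuery threshold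
  have h : ∀ i, Measurable fun p : I × I => if x i ≤ p.1 then (1 : ℝ) else 0 := fun i =>
    Measurable.ite (measurableSet_le measurable_const measurable_fst) measurable_const
      measurable_const
  have h2 : Measurable fun p : I × I => (p.2 : ℝ) := measurable_subtype_coe.comp measurable_snd
  exact continuous_abs.measurable.comp
    (((Finset.measurable_sum _ fun i _ => h i).div_const _).sub h2)

theorem measurableSet_thresholdLoss_le (k : ℕ) {n : ℕ} (x : Fin n → I) (α : ℝ) :
    MeasurableSet {t : (Fin k → I) × (Fin k → I) | ∀ j, thresholdLoss (t.1 j) x (t.2 j) ≤ α} := by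
  have h : MeasurableSet (⋂ j : Fin k, (fun t : (Fin k → I) × (Fin k → I) => (t.1 j, t.2 j)) ⁻¹'
      {p : I × I | thresholdLoss p.1 x p.2 ≤ α}) :=
    MeasurableSet.iInter fun j => (measurableSet_le (measurable_thresholdLoss x)
      measurable_const).preimage (((measurable_pi_apply j).comp measurable_fst).prodMk
        ((measurable_pi_apply j).comp measurable_snd))
  convert h
  ext t
  simp

/-! ### The algorithm for threshold queries -/

/-- The algorithm that answers every query by `1 / 2`. -/
noncomputable abbrev constHalf (n : ℕ) : InteractiveAlgorithm I I I n where
  Coins := Unit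
  law := Measure.dirac ()
  answer _ _ _ _ := Set.projIcc 0 1 zero_le_one (1 / 2)
  measurable_answer _ _ := measurable_const

theorem constHalf_transcript_eq {n : ℕ} (A : Adversary I I) (x x' : Fin n → I)
    (c : (constHalf n).Coins) (ω' : A.Coins) (k : ℕ) :
    (constHalf n).transcript A x c ω' k = (constHalf n).transcript A x' c ω' k := by
  induction k with
  | zero => rfl
  | succ k ih => simp only [InteractiveAlgorithm.transcript, ih]

theorem constHalf_isPrivate (n k : ℕ) {ε δ : ℝ} (hε : 0 ≤ ε) (hδ : 0 ≤ δ) :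
    (constHalf n).IsPrivate k ε δ := by
  intro A x x' _ S _
  have e : (constHalf n).interaction A k x = (constHalf n).interaction A k x' := by
    unfold InteractiveAlgorithm.interaction
    congr 1
    funext p
    exact constHalf_transcript_eq A x x' p.1 p.2 k
  rw [e]
  have h1 : 1 ≤ Real.exp ε := Real.one_le_exp hε
  have h2 : 0 ≤ ((constHalf n).interaction A k x').real S := measureReal_nonneg
  nlinarith

theorem constHalf_isAccurate (n : ℕ) {k : ℕ} {α β : ℝ} (h : k = 0 ∨ 1 / 2 ≤ α) (hβ : 0 ≤ β) :
    (constHalf n).IsAccurate thresholdLoss k α β := by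
  intro A x
  rw [one_sub_le_measureReal_iff (measurableSet_thresholdLoss_le k x α) hβ]
  unfold InteractiveAlgorithm.interaction
  rw [Measure.map_apply ((constHalf n).measurable_transcript A x k)
    (measurableSet_thresholdLoss_le k x α).compl]
  refine le_trans (le_of_eq ?_) zero_le
  convert measure_empty (μ := (constHalf n).law.prod A.law)
  refine Set.eq_empty_of_forall_notMem fun p hp => hp fun j => ?_
  rcases h with rfl | h
  · exact j.elim0
  rw [InteractiveAlgorithm.transcript_snd_apply]
  unfold thresholdLoss
  rw [statisticalQuery_threshold _ x (List.Perm.refl _), Set.coe_projIcc]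
  set l := List.ofFn x
  set y := ((constHalf n).transcript A x p.1 p.2 k).1 j
  have h1 : (l.countP (· ≤ y) : ℝ) ≤ n := by
    exact_mod_cast (List.countP_le_length.trans (by simp [l]))
  have h2 : (l.countP (· ≤ y) : ℝ) / n ≤ 1 := div_le_one_of_le₀ h1 (by positivity)
  have h3 : 0 ≤ (l.countP (· ≤ y) : ℝ) / n := by positivity
  have e : max (0 : ℝ) (min 1 (1 / 2)) = 1 / 2 := by norm_num
  rw [e]
  refine le_trans (abs_le.2 ⟨?_, ?_⟩) h <;> linarith

/-- The datasets of the copies of the online interior point algorithm: the first `N` entries of each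
leaf, with nominal starts of the leaves at multiples of `n / 2 ^ L`. -/
noncomputable def leafDatasets (n N R L : ℕ) (x : Fin n → I) (b : Noise L) :
    Fin (2 ^ L) → Fin N → I := fun i =>
  padded N (leaves (fun j => (j * n / 2 ^ L : ℕ)) R L 0 (sortedList x) b i)

theorem measurable_estimate (n N m : ℕ) : Measurable (estimate n N m) := measurable_of_finite _

section

open InteractiveAlgorithm

/-- Threshold queries by `2 ^ L` copies of `T` on the leaves of a random partition with noise of
weight `w` and gaps of length `R`. -/
noncomputable abbrev thresholdAlgorithm {N : ℕ} (T : InteractiveAlgorithm I I Side N) (n R L : ℕ)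
    {w : ℤ → ENNReal} (hw : ∑' z, w z = 1) : InteractiveAlgorithm I I I n :=
  (T.symmetrize.parallel (measurable_estimate n N (2 ^ L))).preprocess (noisePMF hw L)
    (leafDatasets n N R L)

theorem thresholdAlgorithm_interaction_apply {N : ℕ} (T : InteractiveAlgorithm I I Side N)
    (n R L : ℕ) {w : ℤ → ENNReal} (hw : ∑' z, w z = 1) (A : Adversary I I) (k : ℕ) (x : Fin n → I)
    {S : Set ((Fin k → I) × (Fin k → I))} (hS : MeasurableSet S) :
    (thresholdAlgorithm T n R L hw).interaction A k x S = noiseMean w L fun b =>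
      (T.symmetrize.parallel (measurable_estimate n N (2 ^ L))).interaction A k
        (leafDatasets n N R L x b) S :=
  interaction_preprocess_apply _ _ _ _ _ _ hS

/-- Privacy of the copies of `T` for families of lists that differ in one list. -/
theorem parallel_interaction_le_of_relAtOne {N k m : ℕ} {T : InteractiveAlgorithm I I Side N}
    {f : (Fin m → Side) → I} (hf : Measurable f) {ε δ : ℝ} (hε : 0 ≤ ε) (hδ : 0 ≤ δ)
    (hT : T.IsPrivate k ε δ) (A : Adversary I I) {S : Set ((Fin k → I) × (Fin k → I))}
    (hS : MeasurableSet S) {r : List I → List I → Prop}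
    (hr : ∀ l l', r l l' → ∃ τ : Equiv.Perm (Fin N), Adjacent (padded N l) (padded N l' ∘ τ))
    {D D' : ℕ → List I} (h : RelAtOne r D D') :
    (T.symmetrize.parallel hf).interaction A k (fun i => padded N (D i)) S ≤
      ENNReal.ofReal (Real.exp ε) *
        (T.symmetrize.parallel hf).interaction A k (fun i => padded N (D' i)) S +
      ENNReal.ofReal δ := by
  obtain ⟨i, hi, hl⟩ := h
  by_cases him : i < m
  · obtain ⟨τ, hτ⟩ := hr _ _ hi
    have e1 : (fun i : Fin m => padded N (D i)) =
        Function.update (fun i : Fin m => padded N (D i)) ⟨i, him⟩ (padded N (D i)) := by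
      rw [eq_comm, Function.update_eq_self_iff]
    have e2 : (fun i : Fin m => padded N (D' i)) =
        Function.update (fun i : Fin m => padded N (D i)) ⟨i, him⟩ (padded N (D' i)) := by
      funext l
      by_cases hli : l = ⟨i, him⟩
      · subst hli; simp
      · rw [Function.update_of_ne hli, hl l fun h => hli (Fin.ext h)]
    rw [e1, e2]
    exact interaction_parallel_le _ hf A _ _ ENNReal.ofReal_ne_top
      (fun A S hS => hT.symmetrize_le hδ hτ A hS) hS
  · have e : (fun i : Fin m => padded N (D i)) = fun i : Fin m => padded N (D' i) := by
      funext l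
      rw [hl l (by have := l.2; omega)]
    rw [e]
    refine le_trans ?_ le_self_add
    refine le_mul_of_one_le_left' ?_
    rw [ENNReal.one_le_ofReal]
    exact Real.one_le_exp hε

theorem thresholdAlgorithm_isPrivate {N k n R L : ℕ} {T : InteractiveAlgorithm I I Side N}
    (hN : 1 ≤ N) {ε δ η : ℝ} (hε : 0 ≤ ε) (hδ : 0 ≤ δ) (hη : 0 < η) (hT : T.IsPrivate k ε δ)
    (hpar : (Real.exp η * (1 + 1 / ((R : ℝ) + 1))) ^ L * Real.exp η ^ L ≤ Real.exp (2 * ε))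
    (hw : ∑' z, laplaceWeight (Real.exp (-η)) z = 1) :
    (thresholdAlgorithm T n R L hw).IsPrivate k (4 * ε) ((1 + Real.exp ε) * δ) := by
  intro A x x' hx S hS
  refine measureReal_le_of_measure_le (Real.exp_pos _).le (by positivity) ?_
  rw [thresholdAlgorithm_interaction_apply _ _ _ _ _ _ _ _ hS,
    thresholdAlgorithm_interaction_apply _ _ _ _ _ _ _ _ hS]
  set c := ENNReal.ofReal (Real.exp ε) with hc
  set d := ENNReal.ofReal δ with hd
  set π : ℕ → ℤ := fun j => (j * n / 2 ^ L : ℕ)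
  set P : (ℕ → List I) → ENNReal := fun D =>
    (T.symmetrize.parallel (measurable_estimate n N (2 ^ L))).interaction A k
      (fun i => padded N (D i)) S with hP
  set q := Real.exp (-η) with hq
  have hq0 : 0 < q := Real.exp_pos _
  have hq1 : q < 1 := by rw [hq, Real.exp_lt_one_iff]; linarith
  have hqi : q⁻¹ = Real.exp η := by rw [hq, Real.exp_neg, inv_inv]
  obtain ⟨p, p', hpp⟩ := hx.exists_eraseIdx_eq
  have hP1 : ∀ D D', RelAtOne (fun l l' => ∃ p, l' = l.eraseIdx p) D D' → P D ≤ c * P D' + d := by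
    intro D D' h
    refine parallel_interaction_le_of_relAtOne _ hε hδ hT A hS ?_ h
    rintro l _ ⟨p, rfl⟩
    exact exists_adjacent_padded_eraseIdx hN l p
  have hP2 : ∀ D D', RelAtOne (fun l l' => ∃ p, l = l'.eraseIdx p) D D' → P D ≤ c * P D' + d := by
    intro D D' h
    refine parallel_interaction_le_of_relAtOne _ hε hδ hT A hS ?_ h
    rintro _ l ⟨p, rfl⟩
    obtain ⟨τ, hτ⟩ := exists_adjacent_padded_eraseIdx hN l p
    refine ⟨τ⁻¹, ?_⟩
    have := (hτ.comp_perm τ⁻¹).symm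
    convert this using 1
    funext i
    simp
  -- The `δ` terms are subtracted from the probabilities (truncated at `0`) before the partitions are
  -- compared, so that they are not multiplied by the factors that the comparison costs.
  have hdel := transports_erase hq0 hq1 π R L 0 (sortedList x) _ ⟨p, rfl⟩
    (fun D => P D - (d + c * d)) (fun D => c * P D - c * d) (by
      intro D D' h
      rw [tsub_le_iff_right]
      calc P D ≤ c * P D' + d := hP1 D D' h
        _ ≤ (c * P D' - c * d + c * d) + d := by gcongr; exact le_tsub_add
        _ = _ := by ring)
  have hins := transports_insert hq0 hq1 π R L 0 ((sortedList x).eraseIdx p) (sortedList x')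
    ⟨p', hpp⟩ (fun D => c * P D - c * d) (fun D => c * (c * P D)) (by
      intro D D' h
      rw [tsub_le_iff_right, ← mul_add]
      gcongr
      exact hP2 D D' h)
  have hC : ENNReal.ofReal (q⁻¹ * (1 + 1 / ((R : ℝ) + 1))) ^ L * ENNReal.ofReal q⁻¹ ^ L * (c * c) ≤
      ENNReal.ofReal (Real.exp (4 * ε)) := by
    rw [hqi, hc, ← ENNReal.ofReal_pow (by positivity), ← ENNReal.ofReal_pow (by positivity),
      ← ENNReal.ofReal_mul (by positivity), ← ENNReal.ofReal_mul (by positivity),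
      ← ENNReal.ofReal_mul (by positivity)]
    refine ENNReal.ofReal_le_ofReal ?_
    calc _ ≤ Real.exp (2 * ε) * (Real.exp ε * Real.exp ε) := by gcongr
      _ = _ := by rw [← Real.exp_add, ← Real.exp_add]; congr 1; ring
  have hD : ENNReal.ofReal ((1 + Real.exp ε) * δ) = d + c * d := by
    rw [hc, hd, ← ENNReal.ofReal_mul (by positivity), ← ENNReal.ofReal_add hδ (by positivity)]
    congr 1; ring
  rw [hD]
  calc noiseMean (laplaceWeight q) L (fun b => P (leaves π R L 0 (sortedList x) b))
      ≤ noiseMean (laplaceWeight q) L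
        (fun b => (P (leaves π R L 0 (sortedList x) b) - (d + c * d)) + (d + c * d)) :=
        noiseMean_mono fun b => le_tsub_add
    _ = noiseMean (laplaceWeight q) L
        (fun b => P (leaves π R L 0 (sortedList x) b) - (d + c * d)) + (d + c * d) := by
        rw [noiseMean_add, noiseMean_const hw]
    _ ≤ ENNReal.ofReal (q⁻¹ * (1 + 1 / ((R : ℝ) + 1))) ^ L * (ENNReal.ofReal q⁻¹ ^ L *
        (c * (c * noiseMean (laplaceWeight q) L
          (fun b => P (leaves π R L 0 (sortedList x') b))))) + (d + c * d) := by
        rw [noiseMean_mul_left, noiseMean_mul_left] at hins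
        gcongr
        exact hdel.trans (by gcongr)
    _ = (ENNReal.ofReal (q⁻¹ * (1 + 1 / ((R : ℝ) + 1))) ^ L * ENNReal.ofReal q⁻¹ ^ L * (c * c)) *
        noiseMean (laplaceWeight q) L (fun b => P (leaves π R L 0 (sortedList x') b)) +
        (d + c * d) := by ring
    _ ≤ _ := by
        gcongr
        exact le_rfl

open Classical in
theorem thresholdAlgorithm_isAccurate {N k n R L : ℕ} {T : InteractiveAlgorithm I I Side N}
    {α β γ η t : ℝ} (hn : 0 < n) (hβ : 0 ≤ β) (hγ : 0 ≤ γ) (hη : 0 < η) (hT : SolvesOIP T k γ)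
    (hmγ : 2 ^ L * γ ≤ β / 2)
    (htail : 2 * 2 ^ L * (4 / 3) ^ L * Real.exp (-(η / 2 * t)) ≤ β / 2)
    (hα : (n : ℝ) / 2 ^ L + 1 + N + 2 * t ≤ 2 * α * n)
    (hN : (N : ℝ) + R + 2 * t + 1 ≤ n / 2 ^ L)
    (hw : ∑' z, laplaceWeight (Real.exp (-η)) z = 1) :
    (thresholdAlgorithm T n R L hw).IsAccurate thresholdLoss k α β := by
  intro A x
  have hS := measurableSet_thresholdLoss_le k x α
  set S := {t : (Fin k → I) × (Fin k → I) | ∀ j, thresholdLoss (t.1 j) x (t.2 j) ≤ α} with hSdef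
  rw [one_sub_le_measureReal_iff hS hβ, thresholdAlgorithm_interaction_apply _ _ _ _ _ _ _ _ hS.compl]
  set M := T.symmetrize.parallel (measurable_estimate n N (2 ^ L)) with hM
  have hpoint : ∀ b : Noise L, M.interaction A k (leafDatasets n N R L x b) Sᶜ ≤
      (if ∀ i < 2 ^ L, |(deviation L b i : ℝ)| ≤ t then 0 else 1) + ENNReal.ofReal (β / 2) := by
    intro b
    by_cases hb : ∀ i < 2 ^ L, |(deviation L b i : ℝ)| ≤ t
    · rw [if_pos hb, zero_add]
      set D := leafDatasets n N R L x b with hD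
      unfold interaction
      rw [Measure.map_apply (M.measurable_transcript A D k) hS.compl]
      have hsub : (fun p : M.Coins × A.Coins => M.transcript A D p.1 p.2 k) ⁻¹' Sᶜ ⊆
          ⋃ i₀, {p : (Fin (2 ^ L) → T.symmetrize.Coins) × A.Coins |
            ((M.transcript A D p.1 p.2 k).1,
            fun j : Fin k => T.symmetrize.answer (D i₀) (p.1 i₀) j fun l =>
              (M.transcript A D p.1 p.2 k).1 (Fin.castLE j.2 l)) ∈ (oipSuccess k (D i₀))ᶜ} := by
        intro p hp
        by_contra hcon
        rw [Set.mem_iUnion, not_exists] at hcon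
        have hgood : ∀ i, ((M.transcript A D p.1 p.2 k).1,
            fun j : Fin k => T.symmetrize.answer (D i) (p.1 i) j fun l =>
              (M.transcript A D p.1 p.2 k).1 (Fin.castLE j.2 l)) ∈ oipSuccess k (D i) :=
          fun i => not_not.1 (hcon i)
        refine hp fun j => ?_
        rw [transcript_snd_apply]
        refine thresholdLoss_estimate_le (h := L) (R := R) (t := t) hn (by simp) x _
          (sortedList_pairwise x) (sortedList_perm x) b hb ?_ ?_ _ fun i => hgood i j
        · exact_mod_cast hα
        · exact_mod_cast hN
      refine (measure_mono hsub).trans ((measure_iUnion_fintype_le _ _).trans ?_)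
      calc _ ≤ ∑ _i : Fin (2 ^ L), ENNReal.ofReal γ := by
            refine Finset.sum_le_sum fun i _ => ?_
            exact measure_copy_le T.symmetrize (measurable_estimate n N (2 ^ L)) A D i
              (measurableSet_oipSuccess k (D i)).compl fun A => hT.symmetrize_le hγ A (D i)
        _ = ENNReal.ofReal (2 ^ L * γ) := by
            rw [Finset.sum_const, Finset.card_univ, Fintype.card_fin, nsmul_eq_mul,
              ENNReal.ofReal_mul (by positivity), ← ENNReal.ofReal_natCast]
            push_cast
            rfl
        _ ≤ _ := ENNReal.ofReal_le_ofReal hmγ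
    · rw [if_neg hb]
      exact prob_le_one.trans le_self_add
  calc _ ≤ noiseMean (laplaceWeight (Real.exp (-η))) L (fun b =>
        (if ∀ i < 2 ^ L, |(deviation L b i : ℝ)| ≤ t then 0 else 1) + ENNReal.ofReal (β / 2)) :=
        noiseMean_mono hpoint
    _ ≤ ENNReal.ofReal (β / 2) + ENNReal.ofReal (β / 2) := by
        rw [noiseMean_add, noiseMean_const hw]
        gcongr
        exact (noiseMean_deviation_tail hη L).trans (ENNReal.ofReal_le_ofReal htail)
    _ = ENNReal.ofReal β := by
        rw [← ENNReal.ofReal_add (by linarith) (by linarith)]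
        congr 1; ring

end

theorem theorem5p7 (k n' : ℕ) (α β ε δ : ℝ) (hα : 0 < α) (hα1 : α < 1) (hβ : 0 < β) (hβ1 : β < 1)
    (hε : 0 < ε) (hδ : 0 ≤ δ)
    (hOIP : ∃ T : InteractiveAlgorithm I I Side n',
      T.IsPrivate k ε δ ∧ SolvesOIP T k (α * β / 8)) :
    ∀ n : ℕ,
      max (6 * n' / α) (24 * Real.log (4 / α) ^ (5 / 2 : ℝ) * Real.log (2 / β) / (α * ε)) ≤ (n : ℝ) →
      ∃ M : InteractiveAlgorithm I I I n,
        M.IsPrivate k (4 * ε) ((1 + Real.exp ε) * δ) ∧ M.IsAccurate thresholdLoss k α β := by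
  intro n hn
  by_cases htriv : k = 0 ∨ 1 / 2 ≤ α
  · exact ⟨constHalf n, constHalf_isPrivate n k (by positivity) (by positivity),
      constHalf_isAccurate n htriv hβ.le⟩
  push Not at htriv
  obtain ⟨hk, hα2⟩ := htriv
  obtain ⟨T, hT, hT'⟩ := hOIP
  have hN : 1 ≤ n' := hT'.one_le_of_pos (by nlinarith) (Nat.pos_of_ne_zero hk)
  have hn0 : 0 < n := by
    have h1 : 0 < 6 * (n' : ℝ) / α := by positivity
    exact_mod_cast h1.trans_le ((le_max_left _ _).trans hn)
  obtain ⟨L, R, η, t, hη, h1, h2, h3, h4, h5⟩ := exists_parameters hα hα2 hβ hβ1 hε hN hn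
  have hw : ∑' z, laplaceWeight (Real.exp (-η)) z = 1 :=
    tsum_laplaceWeight (Real.exp_pos _) (by rw [Real.exp_lt_one_iff]; linarith)
  exact ⟨thresholdAlgorithm T n R L hw,
    thresholdAlgorithm_isPrivate hN hε.le hδ hη hT h5 hw,
    thresholdAlgorithm_isAccurate hn0 hβ.le (by positivity) hη hT' h1 h2 h3 h4 hw⟩
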